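/- Let $\mathbf{k}$ be a commutative ring. A composition is a finite sequence $\alpha=(\alpha_1,\ldots,\alpha_\ell)$ of positive integers; $|\alpha|=\alpha_1+\cdots+\alpha_\ell$ is its size, $D(\alpha)=\{\alpha_1+\cdots+\alpha_i \mid 1\le i\le \ell-1\}$, and $\operatorname{Comp}$ is the set of all compositions. For a composition $\alpha$ of size $n$, let $\omega(\alpha)$ be the unique composition of size $n$ with $D(\omega(\alpha))=\{1,\ldots,n-1\}\setminus D(\alpha_\ell,\ldots,\alpha_1)$. Let $\operatorname{QSym}$ be the Hopf algebra of quasisymmetric functions over $\mathbf{k}$, with counit $\varepsilon$ (the constant coefficient) and fundamental basis $F_\alpha=\sum x_{i_1}x_{i_2}\cdots x_{i_n}$, where $n=|\alpha|$ and the sum is over all $i_1\le i_2\le\cdots\le i_n$ with $i_j<i_{j+1}$ for all $j\in D(\alpha)$. Let $\operatorname{NSym}$ be the algebra of noncommutative symmetric functions over $\mathbf{k}$, let $(\cdot,\cdot):\operatorname{NSym}\times\operatorname{QSym}\to\mathbf{k}$ be the standard pairing (for which the complete basis $(H_\alpha)$, $H_\alpha=H_{\alpha_1}\cdots H_{\alpha_\ell}$,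 is dual to the monomial basis $(M_\alpha)$), and let $(R_\alpha)$ be the ribbon basis of $\operatorname{NSym}$, dual to $(F_\alpha)$. For $g\in\operatorname{NSym}$, let $g^\perp:\operatorname{QSym}\to\operatorname{QSym}$ be the linear map adjoint to left multiplication by $g$, that is, $(a,g^\perp c)=(ga,c)$ for all $a\in\operatorname{NSym}$ and $c\in\operatorname{QSym}$. Let $f\in\operatorname{QSym}$ and let $m$ be a positive integer. For any composition $\alpha=(\alpha_1,\ldots,\alpha_\ell)$, define $F_\alpha^{\setminus m}\in\operatorname{QSym}$ as follows: $F_\alpha^{\setminus m}=0$ if $\ell=0$ or $\alpha_\ell<m$; $F_\alpha^{\setminus m}=F_{(\alpha_1,\ldots,\alpha_{\ell-1})}$ if $\ell>0$ and $\alpha_\ell=m$; $F_\alpha^{\setminus m}=F_{(\alpha_1,\ldots,\alpha_{\ell-1},\alpha_\ell-m)}$ if $\ell>0$ and $\alpha_\ell>m$. Then all but finitely many compositions $\alpha$ satisfy $R_{\omega(\alpha)}^\perp f=0$, and $$(-1)^m\sum_{\alpha\in\operatorname{Comp}}(-1)^{|\alpha|}F_\alpha^{\setminus m}\,R_{\omega(\alpha)}^\perp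 f=\varepsilon\left(R_{(1^m)}^\perp f\right),$$ where $(1^m)=(1,1,\ldots,1)$ with $m$ entries, and the scalar on the right is regarded as an element of $\operatorname{QSym}$. -/

import Mathlib

namespace QuasiSymm

open Finset

/-! ### Compositions -/

/-- A composition is a finite sequence of positive integers. -/
abbrev Comp : Type := List ℕ+

namespace Comp

/-- The size `|α| = α₁ + α₂ + ⋯ + α_ℓ`. -/
def size (α : Comp) : ℕ := (α.map (fun a : ℕ+ => (a : ℕ))).sum

/-- The set of partial sums
`D(α) = {α₁, α₁ + α₂, …, α₁ + ⋯ + α_{ℓ-1}}`. -/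
def D (α : Comp) : Finset ℕ :=
  (Finset.Ioo 0 α.length).image fun i => size (α.take i)

@[simp] theorem size_nil : size [] = 0 := rfl

@[simp] theorem size_cons (a : ℕ+) (α : Comp) : size (a :: α) = (a : ℕ) + size α := by
  simp [size]

theorem size_eq_zero {α : Comp} : size α = 0 ↔ α = [] := by
  cases α with
  | nil => simp
  | cons a t => simp

@[simp] theorem D_nil : D [] = ∅ := by simp [D]

@[simp] theorem D_singleton (a : ℕ+) : D [a] = ∅ := by
  ext x
  simp only [D, mem_image, mem_Ioo, List.length_singleton, notMem_empty, iff_false]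
  omega

theorem mem_D_cons_cons {a b : ℕ+} {t : Comp} {x : ℕ} :
    x ∈ D (a :: b :: t) ↔ x = a ∨ ∃ y ∈ D (b :: t), x = a + y := by
  simp only [D, mem_image, mem_Ioo]
  constructor
  · rintro ⟨i, ⟨h0, h1⟩, rfl⟩
    obtain ⟨i, rfl⟩ : ∃ j, i = j + 1 := ⟨i - 1, by omega⟩
    rcases Nat.eq_zero_or_pos i with rfl | hi
    · left; simp
    · right
      exact ⟨_, ⟨i, ⟨hi, by simpa using h1⟩, rfl⟩, by simp⟩
  · rintro (rfl | ⟨y, ⟨i, ⟨h0, h1⟩, rfl⟩, rfl⟩)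
    · exact ⟨1, by simp, by simp⟩
    · exact ⟨i + 1, ⟨by omega, by simpa using h1⟩, by simp⟩

theorem D_subset (α : Comp) : D α ⊆ Finset.Ioo 0 (size α) := by
  induction α with
  | nil => simp
  | cons a t ih =>
    cases t with
    | nil => simp
    | cons b t =>
      intro x hx
      rcases mem_D_cons_cons.1 hx with rfl | ⟨y, hy, rfl⟩
      · simp
      · have := ih hy
        simp only [mem_Ioo, size_cons] at this ⊢
        omega

/-- A composition is determined by its size and its set of partial sums. -/
theorem ext_D {α β : Comp} (h : size α = size β) (hD : D α = D β) : α = β := by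
  induction α generalizing β with
  | nil => exact (size_eq_zero.1 h.symm).symm
  | cons a t ih =>
    cases β with
    | nil => simp at h
    | cons b s =>
      have key : a = b ∧ D t = D s := by
        cases t with
        | nil =>
          cases s with
          | nil => exact ⟨by simpa using h, rfl⟩
          | cons d s =>
            have : (b : ℕ) ∈ D (b :: d :: s) := mem_D_cons_cons.2 (Or.inl rfl)
            rw [← hD] at this; simp at this
        | cons c t =>
          cases s with
          | nil =>
            have : (a : ℕ) ∈ D (a :: c :: t) := mem_D_cons_cons.2 (Or.inl rfl)
            rw [hD] at this; simp at this
          | cons d s =>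
            have h1 : (a : ℕ) ∈ D (b :: d :: s) := hD ▸ mem_D_cons_cons.2 (Or.inl rfl)
            have h2 : (b : ℕ) ∈ D (a :: c :: t) := hD ▸ mem_D_cons_cons.2 (Or.inl rfl)
            have hab : (a : ℕ) = b := by
              rcases mem_D_cons_cons.1 h1 with e | ⟨y, -, e⟩
              · exact e
              · rcases mem_D_cons_cons.1 h2 with e' | ⟨z, -, e'⟩ <;> omega
            refine ⟨PNat.coe_injective hab, ?_⟩
            ext y
            have e : (a : ℕ) + y ∈ D (a :: c :: t) ↔ (a : ℕ) + y ∈ D (b :: d :: s) := by rw [hD]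
            have hc : y ∈ D (c :: t) → 0 < y := fun hy => (mem_Ioo.1 (D_subset _ hy)).1
            have hd : y ∈ D (d :: s) → 0 < y := fun hy => (mem_Ioo.1 (D_subset _ hy)).1
            rw [mem_D_cons_cons, mem_D_cons_cons] at e
            constructor
            · intro hy
              rcases e.1 (Or.inr ⟨y, hy, rfl⟩) with e | ⟨z, hz, e⟩
              · have := hc hy; omega
              · have : y = z := by omega
                exact this ▸ hz
            · intro hy
              rcases e.2 (Or.inr ⟨y, hy, by omega⟩) with e | ⟨z, hz, e⟩
              · have := hd hy; omega
              · have : y = z := by omega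
                exact this ▸ hz
      obtain ⟨rfl, hts⟩ := key
      rw [ih (by simpa using h) hts]

theorem exists_of_D (n : ℕ) (S : Finset ℕ) (hS : S ⊆ Finset.Ioo 0 n) :
    ∃ α : Comp, size α = n ∧ D α = S := by
  induction n using Nat.strong_induction_on generalizing S with
  | _ n ih =>
    rcases S.eq_empty_or_nonempty with rfl | hne
    · rcases Nat.eq_zero_or_pos n with rfl | hn
      · exact ⟨[], by simp⟩
      · exact ⟨[n.toPNat hn], by rw [size_cons]; simp; rfl, D_singleton _⟩
    · have ha := mem_Ioo.1 (hS (S.min'_mem hne))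
      set a := S.min' hne with hadef
      obtain ⟨β, hβ, hD⟩ := ih (n - a) (by omega)
        ((S.erase a).image fun x => x - a) (by
          intro y hy
          obtain ⟨x, hx, rfl⟩ := mem_image.1 hy
          have h1 := mem_Ioo.1 (hS (mem_of_mem_erase hx))
          have h2 := S.min'_le x (mem_of_mem_erase hx)
          have h3 := ne_of_mem_erase hx
          rw [mem_Ioo]; omega)
      cases β with
      | nil => simp at hβ; omega
      | cons b t =>
        have hcoe : ((a.toPNat ha.1 : ℕ+) : ℕ) = a := rfl
        refine ⟨a.toPNat ha.1 :: b :: t, ?_, ?_⟩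
        · rw [size_cons, hβ, hcoe]; omega
        · ext x
          rw [mem_D_cons_cons, hD, hcoe]
          simp only [mem_image, mem_erase]
          constructor
          · rintro (rfl | ⟨y, ⟨z, ⟨hz, hzS⟩, rfl⟩, rfl⟩)
            · exact S.min'_mem hne
            · have := S.min'_le z hzS
              rwa [show a + (z - a) = z by omega]
          · intro hx
            by_cases hxa : x = a
            · exact Or.inl hxa
            · have := S.min'_le x hx
              exact Or.inr ⟨_, ⟨x, ⟨hxa, hx⟩, rfl⟩, by omega⟩

/-- The unique composition `β` of `n` with `D(β) = S` (for `S ⊆ {1, …, n-1}`; elements of `S`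
outside `{1, …, n-1}` are discarded). -/
noncomputable def ofD (n : ℕ) (S : Finset ℕ) : Comp :=
  (exists_of_D n (S ∩ Finset.Ioo 0 n) inter_subset_right).choose

theorem size_ofD (n : ℕ) (S : Finset ℕ) : size (ofD n S) = n :=
  (exists_of_D n (S ∩ Finset.Ioo 0 n) inter_subset_right).choose_spec.1

theorem D_ofD {n : ℕ} {S : Finset ℕ} (hS : S ⊆ Finset.Ioo 0 n) : D (ofD n S) = S :=
  (exists_of_D n (S ∩ Finset.Ioo 0 n) inter_subset_right).choose_spec.2.trans
    (inter_eq_left.2 hS)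

/-- `ω(α)`: the unique composition `β` of `n = |α|` such that
`D(β) = {1, …, n-1} \ D(rev α)`. -/
noncomputable def omega (α : Comp) : Comp :=
  ofD (size α) (Finset.Ioo 0 (size α) \ D α.reverse)

theorem size_omega (α : Comp) : size (omega α) = size α := size_ofD _ _

theorem D_omega (α : Comp) : D (omega α) = Finset.Ioo 0 (size α) \ D α.reverse :=
  D_ofD sdiff_subset

end Comp

/-! ### Monomials -/

/-- The monomial `x_{i₁}^{α₁} x_{i₂}^{α₂} ⋯ x_{i_ℓ}^{α_ℓ}`. Monomials in the variables
`x_0, x_1, x_2, …` are exponent vectors `ℕ →₀ ℕ`. -/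
noncomputable def monomialAt (α : Comp) (i : Fin α.length → ℕ) : ℕ →₀ ℕ :=
  ∑ t, Finsupp.single (i t) (α.get t : ℕ)

/-- Two monomials are pack-equivalent if they are `x_{i₁}^{α₁} ⋯ x_{i_ℓ}^{α_ℓ}` and
`x_{j₁}^{α₁} ⋯ x_{j_ℓ}^{α_ℓ}` with the same positive exponents, `i₁ < ⋯ < i_ℓ` and
`j₁ < ⋯ < j_ℓ`. -/
def PackEquiv (m n : ℕ →₀ ℕ) : Prop :=
  ∃ (α : Comp) (i j : Fin α.length → ℕ), StrictMono i ∧ StrictMono j ∧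
    m = monomialAt α i ∧ n = monomialAt α j

/-- The sequence of the nonzero exponents of a monomial, in increasing order of the variables. -/
def pack {σ : Type*} [LinearOrder σ] (m : σ →₀ ℕ) : Comp :=
  m.support.sort.map fun i => (m i).toPNat'

/-- The first monomial `x_0^{α₁} x_1^{α₂} ⋯ x_{ℓ-1}^{α_ℓ}` in the pack-equivalence class
given by `α`. -/
noncomputable def stdMonomial (α : Comp) : ℕ →₀ ℕ := monomialAt α fun t => (t : ℕ)

theorem pack_mapDomain {σ τ : Type*} [LinearOrder σ] [LinearOrder τ] {i : σ → τ}
    (hi : StrictMono i) (m : σ →₀ ℕ) : pack (m.mapDomain i) = pack m := by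
  have hs : (m.mapDomain i).support = m.support.map ⟨i, hi.injective⟩ := by
    rw [Finsupp.mapDomain_support_of_injective hi.injective, Finset.map_eq_image]; rfl
  have hsort : (m.mapDomain i).support.sort = m.support.sort.map i := by
    rw [hs, ← StrictMonoOn.map_finsetSort (f := ⟨i, hi.injective⟩) _ (hi.strictMonoOn _)]
    rfl
  rw [pack, pack, hsort, List.map_map]
  refine List.map_congr_left fun a _ => ?_
  simp [Finsupp.mapDomain_apply hi.injective]

/-- The exponent vector of `α` on the index set `{0, …, ℓ-1}`. -/
noncomputable def expVec (α : Comp) : Fin α.length →₀ ℕ :=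
  Finsupp.equivFunOnFinite.symm fun t => (α.get t : ℕ)

theorem monomialAt_eq (α : Comp) (i : Fin α.length → ℕ) :
    monomialAt α i = (expVec α).mapDomain i := by
  rw [monomialAt, Finsupp.mapDomain, Finsupp.sum_fintype _ _ (by simp)]
  rfl

theorem pack_expVec (α : Comp) : pack (expVec α) = α := by
  have hs : (expVec α).support = Finset.univ := by
    ext t; simp [expVec]
  rw [pack, hs, Fin.sort_univ]
  refine List.ext_getElem (by simp) fun t h1 h2 => ?_
  simp [expVec]

theorem pack_monomialAt {α : Comp} {i : Fin α.length → ℕ} (hi : StrictMono i) :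
    pack (monomialAt α i) = α := by
  rw [monomialAt_eq, pack_mapDomain hi, pack_expVec]

@[simp] theorem pack_stdMonomial (α : Comp) : pack (stdMonomial α) = α :=
  pack_monomialAt Fin.val_strictMono

theorem exists_monomialAt (m : ℕ →₀ ℕ) :
    ∃ i : Fin (pack m).length → ℕ, StrictMono i ∧ m = monomialAt (pack m) i := by
  have hl : (pack m).length = m.support.sort.length := by simp [pack]
  refine ⟨fun t => m.support.sort.get (t.cast hl), ?_, ?_⟩
  · intro a b hab
    exact (Finset.sortedLT_sort m.support).strictMono_get (by simpa using hab)
  · have h1 : ∀ t : Fin (pack m).length, ((pack m).get t : ℕ) =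
        m (m.support.sort.get (t.cast hl)) := by
      intro t
      have hmem := (Finset.mem_sort (α := ℕ) (· ≤ ·)).1 (m.support.sort.get_mem (t.cast hl))
      have hp : 0 < m (m.support.sort.get (t.cast hl)) :=
        Nat.pos_of_ne_zero (Finsupp.mem_support_iff.1 hmem)
      simp only [List.get_eq_getElem, Fin.val_cast] at hp ⊢
      simp only [pack, List.getElem_map]
      rw [Nat.toPNat'_coe, if_pos hp]
    rw [monomialAt]
    simp only [h1]
    refine Eq.trans ?_ (Fintype.sum_equiv (finCongr hl) _
      (fun t : Fin m.support.sort.length =>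
        Finsupp.single (m.support.sort.get t) (m (m.support.sort.get t))) (fun t => rfl)).symm
    have hlist : ∀ l : List ℕ, ∑ t : Fin l.length, Finsupp.single (l.get t) (m (l.get t)) =
        (l.map fun a => Finsupp.single a (m a)).sum := by
      intro l
      rw [← List.sum_ofFn]
      congr 1
      exact List.ext_getElem (by simp) (by simp)
    rw [hlist, ← Multiset.sum_coe, ← Multiset.map_coe, Finset.sort_eq]
    exact (Finsupp.sum_single m).symm

theorem packEquiv_iff {m n : ℕ →₀ ℕ} : PackEquiv m n ↔ pack m = pack n := by
  constructor
  · rintro ⟨α, i, j, hi, hj, rfl, rfl⟩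
    rw [pack_monomialAt hi, pack_monomialAt hj]
  · intro h
    obtain ⟨i, hi, hm⟩ := exists_monomialAt m
    have hn := exists_monomialAt n
    rw [← h] at hn
    obtain ⟨j, hj, hn⟩ := hn
    exact ⟨pack m, i, j, hi, hj, hm, hn⟩

theorem degree_monomialAt (α : Comp) (i : Fin α.length → ℕ) :
    (monomialAt α i).degree = Comp.size α := by
  rw [monomialAt, map_sum]
  simp only [Finsupp.degree_single]
  rw [← List.sum_ofFn, Comp.size]
  congr 1
  exact List.ext_getElem (by simp) (by simp)

theorem size_pack (m : ℕ →₀ ℕ) : Comp.size (pack m) = m.degree := by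
  obtain ⟨i, -, hm⟩ := exists_monomialAt m
  conv_rhs => rw [hm]
  rw [degree_monomialAt]

/-! ### Quasisymmetric functions -/

section

variable (k : Type*) [CommRing k]

/-- Every monomial of sufficiently large degree has coefficient `0`. -/
def IsBoundedDegree {k : Type*} [CommRing k] (P : MvPowerSeries ℕ k) : Prop :=
  ∃ N : ℕ, ∀ m : ℕ →₀ ℕ, N < m.degree → MvPowerSeries.coeff m P = 0

/-- Pack-equivalent monomials have equal coefficients. -/
def IsQuasisymmetric {k : Type*} [CommRing k] (P : MvPowerSeries ℕ k) : Prop :=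
  ∀ m n : ℕ →₀ ℕ, PackEquiv m n → MvPowerSeries.coeff m P = MvPowerSeries.coeff n P

theorem IsQuasisymmetric.mapDomain {k : Type*} [CommRing k] {P : MvPowerSeries ℕ k}
    (h : IsQuasisymmetric P) {l : ℕ} (a : Fin l →₀ ℕ) {i j : Fin l → ℕ} (hi : StrictMono i)
    (hj : StrictMono j) :
    MvPowerSeries.coeff (a.mapDomain i) P = MvPowerSeries.coeff (a.mapDomain j) P :=
  h _ _ (packEquiv_iff.2 (by rw [pack_mapDomain hi, pack_mapDomain hj]))

theorem sum_antidiagonal_mapDomain {M : Type*} [AddCommMonoid M] {l : ℕ} (a : Fin l →₀ ℕ)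
    {i : Fin l → ℕ} (hi : StrictMono i) (φ : (ℕ →₀ ℕ) × (ℕ →₀ ℕ) → M) :
    ∑ p ∈ antidiagonal (a.mapDomain i), φ p =
      ∑ p ∈ antidiagonal a, φ (p.1.mapDomain i, p.2.mapDomain i) := by
  have hinj := Finsupp.mapDomain_injective (M := ℕ) hi.injective
  symm
  refine Finset.sum_bij (fun p _ => (p.1.mapDomain i, p.2.mapDomain i)) ?_ ?_ ?_ ?_
  · rintro p hp
    rw [Finset.HasAntidiagonal.mem_antidiagonal] at hp ⊢
    rw [← Finsupp.mapDomain_add, hp]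
  · rintro p - q - h
    rw [Prod.mk.injEq] at h
    exact Prod.ext (hinj h.1) (hinj h.2)
  · rintro ⟨u, v⟩ h
    rw [Finset.HasAntidiagonal.mem_antidiagonal] at h
    have hz : ∀ x, x ∉ Set.range i → u x = 0 ∧ v x = 0 := by
      intro x hx
      have := DFunLike.congr_fun h x
      rw [Finsupp.mapDomain_of_notMem_range _ _ hx] at this
      simpa using this
    refine ⟨(u.comapDomain i hi.injective.injOn, v.comapDomain i hi.injective.injOn), ?_, ?_⟩
    · rw [Finset.HasAntidiagonal.mem_antidiagonal]
      ext t
      have := DFunLike.congr_fun h (i t)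
      rw [Finsupp.mapDomain_apply hi.injective] at this
      simpa using this
    · have key : ∀ w : ℕ →₀ ℕ, (∀ x, x ∉ Set.range i → w x = 0) →
          (w.comapDomain i hi.injective.injOn).mapDomain i = w := by
        intro w hw
        refine Finsupp.mapDomain_comapDomain i hi.injective w ?_
        intro x hx
        by_contra hx'
        exact (Finsupp.mem_support_iff.1 hx) (hw x hx')
      exact Prod.ext (key u fun x hx => (hz x hx).1) (key v fun x hx => (hz x hx).2)
  · intro p _
    rfl

/-- The algebra `QSym` of quasisymmetric functions over `k`: the bounded-degree quasisymmetric
power series in `x_0, x_1, x_2, …`. -/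
noncomputable def QSym : Subalgebra k (MvPowerSeries ℕ k) where
  carrier := {P | IsBoundedDegree P ∧ IsQuasisymmetric P}
  mul_mem' := by
    rintro f g ⟨⟨N, hN⟩, hf⟩ ⟨⟨K, hK⟩, hg⟩
    refine ⟨⟨N + K, fun m hm => ?_⟩, ?_⟩
    · rw [MvPowerSeries.coeff_mul]
      refine Finset.sum_eq_zero fun p hp => ?_
      rw [Finset.HasAntidiagonal.mem_antidiagonal] at hp
      have hd : p.1.degree + p.2.degree = m.degree := by rw [← hp, map_add]
      by_cases h1 : N < p.1.degree
      · rw [hN _ h1, zero_mul]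
      · rw [hK _ (by omega), mul_zero]
    · rintro m n ⟨α, i, j, hi, hj, rfl, rfl⟩
      rw [MvPowerSeries.coeff_mul, MvPowerSeries.coeff_mul, monomialAt_eq, monomialAt_eq,
        sum_antidiagonal_mapDomain _ hi, sum_antidiagonal_mapDomain _ hj]
      refine Finset.sum_congr rfl fun p _ => ?_
      rw [hf.mapDomain p.1 hi hj, hg.mapDomain p.2 hi hj]
  add_mem' := by
    rintro f g ⟨⟨N, hN⟩, hf⟩ ⟨⟨K, hK⟩, hg⟩
    refine ⟨⟨N + K, fun m hm => ?_⟩, fun m n h => ?_⟩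
    · rw [map_add, hN _ (by omega), hK _ (by omega), add_zero]
    · rw [map_add, map_add, hf m n h, hg m n h]
  algebraMap_mem' := by
    intro r
    have hc : ∀ m : ℕ →₀ ℕ, MvPowerSeries.coeff m (algebraMap k (MvPowerSeries ℕ k) r) =
        if m.degree = 0 then r else 0 := by
      intro m
      rw [MvPowerSeries.algebraMap_apply, MvPowerSeries.coeff_C]
      simp [Finsupp.degree_eq_zero_iff]
    refine ⟨⟨0, fun m hm => ?_⟩, fun m n h => ?_⟩
    · rw [hc, if_neg (by omega)]
    · rw [hc, hc, ← size_pack, ← size_pack, packEquiv_iff.1 h]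

variable {k}

theorem mem_QSym {P : MvPowerSeries ℕ k} :
    P ∈ QSym k ↔ IsBoundedDegree P ∧ IsQuasisymmetric P := Iff.rfl

variable (k)

/-- The counit `ε : QSym → k`: the constant coefficient (so `ε(M_∅) = 1` and `ε(M_α) = 0` for
every other monomial quasisymmetric function `M_α`). -/
noncomputable def counit : QSym k →ₗ[k] k :=
  (MvPowerSeries.coeff (R := k) (0 : ℕ →₀ ℕ)).comp (QSym k).val.toLinearMap

/-- The weakly increasing sequences `i₁ ≤ i₂ ≤ ⋯ ≤ i_n`, `n = |α|`, such that `i_j < i_{j+1}` for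
all `j ∈ D(α)` and `x_{i₁} x_{i₂} ⋯ x_{i_n} = m`. The entries are numbered from `0` on, so the
condition for `j` is about the entries number `j - 1` and `j`. -/
def FundamentalSeq {σ : Type*} [LinearOrder σ] (α : Comp) (m : σ →₀ ℕ) : Type _ :=
  {i : Fin (Comp.size α) → σ // Monotone i ∧
    (∀ a b : Fin (Comp.size α), (a : ℕ) + 1 = b → (b : ℕ) ∈ Comp.D α → i a < i b) ∧
    ∑ t, Finsupp.single (i t) 1 = m}

theorem card_fundamentalSeq_mapDomain {l : ℕ} (α : Comp) (a : Fin l →₀ ℕ) {i : Fin l → ℕ}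
    (hi : StrictMono i) :
    Nat.card (FundamentalSeq α (a.mapDomain i)) = Nat.card (FundamentalSeq α a) := by
  symm
  have hinj := Finsupp.mapDomain_injective (M := ℕ) hi.injective
  have hsum : ∀ s : Fin (Comp.size α) → Fin l, ∑ t, Finsupp.single (i (s t)) 1 =
      (∑ t, Finsupp.single (s t) 1 : Fin l →₀ ℕ).mapDomain i := by
    intro s
    rw [Finsupp.mapDomain_finsetSum]
    simp [Finsupp.mapDomain_single]
  refine Nat.card_eq_of_bijective
    (fun s => (⟨i ∘ s.1, hi.monotone.comp s.2.1,
      fun x y hxy hy => hi (s.2.2.1 x y hxy hy), by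
        simp only [Function.comp_apply]; rw [hsum, s.2.2.2]⟩ :
      FundamentalSeq α (a.mapDomain i))) ⟨?_, ?_⟩
  · rintro ⟨s, hs⟩ ⟨u, hu⟩ h
    have h' : i ∘ s = i ∘ u := congrArg Subtype.val h
    exact Subtype.ext (hi.injective.comp_left h')
  · rintro ⟨s, h1, h2, h3⟩
    have hr : ∀ t, ∃ u, i u = s t := by
      intro t
      by_contra hx
      have h4 := DFunLike.congr_fun h3 (s t)
      rw [Finsupp.mapDomain_of_notMem_range _ _ (by simpa using hx), Finsupp.finsetSum_apply,
        Finset.sum_eq_zero_iff] at h4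
      simpa using h4 t (Finset.mem_univ t)
    choose u hu using hr
    obtain rfl : i ∘ u = s := funext hu
    refine ⟨⟨u, fun x y h => hi.le_iff_le.1 (h1 h), fun x y h hy => hi.lt_iff_lt.1 (h2 x y h hy),
      hinj ?_⟩, rfl⟩
    rw [← hsum]
    exact h3

/-- The fundamental quasisymmetric function
`F_α = ∑ x_{i₁} x_{i₂} ⋯ x_{i_n}`, summed over all `i₁ ≤ i₂ ≤ ⋯ ≤ i_n` (where `n = |α|`)
with `i_j < i_{j+1}` for all `j ∈ D(α)`. -/
noncomputable def F (α : Comp) : QSym k :=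
  ⟨fun m => (Nat.card (FundamentalSeq α m) : k), by
    constructor
    · refine ⟨Comp.size α, fun m hm => ?_⟩
      have : IsEmpty (FundamentalSeq α m) := by
        refine ⟨fun s => ?_⟩
        have := s.2.2.2
        rw [← this, map_sum] at hm
        simp at hm
      change ((Nat.card (FundamentalSeq α m) : ℕ) : k) = 0
      rw [Nat.card_of_isEmpty, Nat.cast_zero]
    · rintro m n ⟨β, i, j, hi, hj, rfl, rfl⟩
      change ((Nat.card (FundamentalSeq α _) : ℕ) : k) = ((Nat.card (FundamentalSeq α _) : ℕ) : k)
      rw [monomialAt_eq, monomialAt_eq, card_fundamentalSeq_mapDomain _ _ hi,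
        card_fundamentalSeq_mapDomain _ _ hj]⟩

/-! ### Noncommutative symmetric functions -/

/-- The algebra `NSym` of noncommutative symmetric functions over `k`: the free associative
algebra on generators `H_1, H_2, H_3, …`. -/
abbrev NSym : Type _ := MonoidAlgebra k (FreeMonoid ℕ+)

/-- The complete basis `H_α = H_{α₁} H_{α₂} ⋯ H_{α_ℓ}` of `NSym`. -/
noncomputable def H (α : Comp) : NSym k := MonoidAlgebra.single (FreeMonoid.ofList α) 1

theorem H_mul (α β : Comp) : H k α * H k β = H k (α ++ β) := by
  rw [H, H, MonoidAlgebra.single_mul_single, mul_one]; rfl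

/-- The coefficient of the monomial quasisymmetric function `M_α` in a quasisymmetric function,
that is, the coefficient of the monomial `x_0^{α₁} x_1^{α₂} ⋯ x_{ℓ-1}^{α_ℓ}`. -/
noncomputable def coeffM (α : Comp) : QSym k →ₗ[k] k :=
  (MvPowerSeries.coeff (R := k) (stdMonomial α)).comp (QSym k).val.toLinearMap

/-- The pairing between `NSym` and `QSym`: the bilinear form for which the complete basis
`(H_α)` of `NSym` and the monomial basis `(M_α)` of `QSym` are dual to each other. -/
noncomputable def pairing : NSym k →ₗ[k] QSym k →ₗ[k] k :=
  (Finsupp.linearCombination k fun w : FreeMonoid ℕ+ => coeffM k w.toList).comp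
    (MonoidAlgebra.coeffLinearEquiv k).toLinearMap

variable {k}

@[simp] theorem pairing_H (α : Comp) (f : QSym k) : pairing k (H k α) f = coeffM k α f := by
  simp [pairing, H]

theorem coeff_eq_coeffM (f : QSym k) (m : ℕ →₀ ℕ) :
    MvPowerSeries.coeff m (f : MvPowerSeries ℕ k) = coeffM k (pack m) f :=
  f.2.2 _ _ (packEquiv_iff.2 (by simp))

/-- The pairing is nondegenerate on the side of `QSym`. -/
theorem ext_pairing {f g : QSym k} (h : ∀ a : NSym k, pairing k a f = pairing k a g) : f = g := by
  refine Subtype.ext (MvPowerSeries.ext fun m => ?_)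
  rw [coeff_eq_coeffM, coeff_eq_coeffM, ← pairing_H, ← pairing_H, h]

theorem nsym_induction {p : NSym k → Prop} (g : NSym k) (zero : p 0)
    (add : ∀ a b, p a → p b → p (a + b)) (smul : ∀ (r : k) (α : Comp), p (r • H k α)) : p g := by
  refine MonoidAlgebra.induction_linear g zero (fun a b => add a b) fun w r => ?_
  have := smul r w.toList
  rwa [H, MonoidAlgebra.smul_single, smul_eq_mul, mul_one] at this

theorem pairing_mul_H_eq_zero {f : QSym k} {N : ℕ}
    (hN : ∀ m : ℕ →₀ ℕ, N < m.degree → MvPowerSeries.coeff m (f : MvPowerSeries ℕ k) = 0)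
    (g : NSym k) {α : Comp} (hα : N < Comp.size α) : pairing k (g * H k α) f = 0 := by
  induction g using nsym_induction with
  | zero => rw [zero_mul, map_zero, LinearMap.zero_apply]
  | add a b ha hb => rw [add_mul, map_add, LinearMap.add_apply, ha, hb, add_zero]
  | smul r β =>
    rw [smul_mul_assoc, H_mul, map_smul, LinearMap.smul_apply, pairing_H]
    have : coeffM k (β ++ α) f = 0 := hN _ (by
      rw [stdMonomial, degree_monomialAt]
      simp only [Comp.size, List.map_append, List.sum_append] at hα ⊢
      omega)
    rw [this, smul_zero]

/-- For `g ∈ NSym`, the map `g^⊥ : QSym → QSym` adjoint to the left multiplication by `g` on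
`NSym`: the coefficient of `M_α` in `g^⊥ f` is `(g H_α, f)`. -/
noncomputable def perp (g : NSym k) : QSym k →ₗ[k] QSym k where
  toFun f := ⟨fun m => pairing k (g * H k (pack m)) f, by
    obtain ⟨⟨N, hN⟩, -⟩ := mem_QSym.1 f.2
    refine ⟨⟨N, fun m hm => ?_⟩, fun m n h => ?_⟩
    · exact pairing_mul_H_eq_zero hN g (by rwa [size_pack])
    · change pairing k (g * H k (pack m)) f = pairing k (g * H k (pack n)) f
      rw [packEquiv_iff.1 h]⟩
  map_add' f f' := Subtype.ext (funext fun m => by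
    change pairing k _ (f + f') = pairing k _ f + pairing k _ f'
    rw [map_add])
  map_smul' r f := Subtype.ext (funext fun m => by
    change pairing k _ (r • f) = r • pairing k _ f
    rw [map_smul])

/-- `g^⊥` is adjoint to the left multiplication by `g`. By `ext_pairing`, this determines it. -/
theorem pairing_perp (g a : NSym k) (f : QSym k) :
    pairing k a (perp g f) = pairing k (g * a) f := by
  induction a using nsym_induction with
  | zero => rw [mul_zero, map_zero, LinearMap.zero_apply, LinearMap.zero_apply]
  | add a b ha hb =>
    rw [mul_add, map_add, map_add, LinearMap.add_apply, LinearMap.add_apply, ha, hb]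
  | smul r β =>
    rw [mul_smul_comm, map_smul, map_smul, LinearMap.smul_apply, LinearMap.smul_apply, pairing_H]
    change r • pairing k (g * H k (pack (stdMonomial β))) f = _
    rw [pack_stdMonomial]

variable (k)

/-- The ribbon basis `R_α = ∑_β (-1)^{ℓ(α) - ℓ(β)} H_β` of `NSym`, summed over the compositions
`β` of `|α|` with `D(β) ⊆ D(α)`. It is the basis dual to `(F_α)`, see `pairing_R_F`. -/
noncomputable def R (α : Comp) : NSym k :=
  ∑ S ∈ (Comp.D α).powerset, (-1 : k) ^ (Comp.D α \ S).card • H k (Comp.ofD (Comp.size α) S)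

/-! ### Duality of the ribbon basis and the fundamental basis -/

variable {k}

/-- The word `k^{α₁} (k+1)^{α₂} (k+2)^{α₃} ⋯`. -/
def blockWord : ℕ → Comp → List ℕ
  | _, [] => []
  | c, a :: t => List.replicate a c ++ blockWord (c + 1) t

theorem length_blockWord (c : ℕ) (α : Comp) : (blockWord c α).length = Comp.size α := by
  induction α generalizing c with
  | nil => rfl
  | cons a t ih => simp [blockWord, ih]

theorem le_of_mem_blockWord {c : ℕ} {α : Comp} {x : ℕ} (h : x ∈ blockWord c α) : c ≤ x := by
  induction α generalizing c with
  | nil => simp [blockWord] at h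
  | cons a t ih =>
    rcases List.mem_append.1 h with h | h
    · exact (List.eq_of_mem_replicate h).ge
    · exact (Nat.le_succ c).trans (ih h)

theorem pairwise_blockWord (c : ℕ) (α : Comp) : (blockWord c α).Pairwise (· ≤ ·) := by
  induction α generalizing c with
  | nil => exact List.Pairwise.nil
  | cons a t ih =>
    rw [blockWord, List.pairwise_append]
    refine ⟨?_, ih _, fun x hx y hy => ?_⟩
    · rw [List.pairwise_replicate]; right; exact le_rfl
    · rw [List.eq_of_mem_replicate hx]
      exact (Nat.le_succ c).trans (le_of_mem_blockWord hy)

theorem blockWord_lt_iff (c : ℕ) (α : Comp) (b : ℕ) (hb : b + 1 < (blockWord c α).length) :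
    (blockWord c α)[b] < (blockWord c α)[b + 1] ↔ b + 1 ∈ Comp.D α := by
  induction α generalizing c b with
  | nil => simp [blockWord] at hb
  | cons a t ih =>
    have hb' : b + 1 < a + Comp.size t := by simpa [length_blockWord] using hb
    simp only [blockWord, List.getElem_append, List.length_replicate, List.getElem_replicate]
    cases t with
    | nil =>
      simp only [Comp.size_nil] at hb'
      rw [dif_pos (by omega), dif_pos (by omega)]
      simp
    | cons d t =>
      rw [Comp.mem_D_cons_cons]
      have hpos : ∀ y ∈ Comp.D (d :: t), 0 < y := fun y hy => (mem_Ioo.1 (Comp.D_subset _ hy)).1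
      rcases lt_trichotomy (b + 1) (a : ℕ) with h | h | h
      · rw [dif_pos (by omega), dif_pos (by omega)]
        simp only [lt_self_iff_false, false_iff]
        rintro (e | ⟨y, hy, e⟩)
        · omega
        · have := hpos y hy; omega
      · rw [dif_pos (by omega), dif_neg (by omega)]
        refine iff_of_true ?_ (Or.inl h)
        exact le_of_mem_blockWord (List.getElem_mem _)
      · rw [dif_neg (by omega), dif_neg (by omega)]
        have := ih (c + 1) (b - a) (by rw [length_blockWord]; omega)
        simp only [show b + 1 - (a : ℕ) = b - a + 1 by omega]
        rw [this]
        constructor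
        · intro hy; exact Or.inr ⟨_, hy, by omega⟩
        · rintro (e | ⟨y, hy, e⟩)
          · omega
          · rwa [show b - (a : ℕ) + 1 = y by omega]

theorem sum_blockWord (c : ℕ) (α : Comp) :
    ((blockWord c α).map fun x => (Finsupp.single x 1 : ℕ →₀ ℕ)).sum =
      monomialAt α fun t => c + t := by
  induction α generalizing c with
  | nil => rfl
  | cons a t ih =>
    rw [blockWord, List.map_append, List.sum_append, ih, monomialAt, monomialAt]
    refine Eq.trans ?_ (Fin.sum_univ_succ (n := t.length) _).symm
    congr 1
    · simp
    · refine Finset.sum_congr rfl fun x _ => ?_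
      simp only [List.get_eq_getElem, Fin.val_succ, List.getElem_cons_succ]
      rw [show c + 1 + (x : ℕ) = c + (x + 1) by omega]

theorem eq_of_monotone_of_sum_eq {n : ℕ} {i j : Fin n → ℕ} (hi : Monotone i) (hj : Monotone j)
    (h : (∑ t, Finsupp.single (i t) 1 : ℕ →₀ ℕ) = ∑ t, Finsupp.single (j t) 1) : i = j := by
  have key : ∀ s : Fin n → ℕ, Finsupp.toMultiset (∑ t, Finsupp.single (s t) 1 : ℕ →₀ ℕ) =
      (List.ofFn s : Multiset ℕ) := by
    intro s
    rw [Finsupp.toMultiset_sum]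
    simp only [Finsupp.toMultiset_single, one_smul]
    rw [← List.sum_ofFn]
    rw [show (List.ofFn fun t => ({s t} : Multiset ℕ)) = (List.ofFn s).map fun x => {x} by
      rw [List.map_ofFn]; rfl]
    rw [← Multiset.sum_coe, ← Multiset.map_coe, Multiset.sum_map_singleton]
  have hp : (List.ofFn i).Perm (List.ofFn j) := by
    rw [← Multiset.coe_eq_coe, ← key, ← key, h]
  exact List.ofFn_injective (hp.eq_of_pairwise' (hi.sortedLE_ofFn.pairwise)
    (hj.sortedLE_ofFn.pairwise))

/-- The coefficient of `M_γ` in `F_α` is `1` if `|γ| = |α|` and `D(α) ⊆ D(γ)`, and `0` otherwise. -/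
theorem coeffM_F (α γ : Comp) : coeffM k γ (F k α) =
    if Comp.size γ = Comp.size α ∧ Comp.D α ⊆ Comp.D γ then 1 else 0 := by
  change ((Nat.card (FundamentalSeq α (stdMonomial γ)) : ℕ) : k) = _
  have hs : Subsingleton (FundamentalSeq α (stdMonomial γ)) :=
    ⟨fun s u => Subtype.ext (eq_of_monotone_of_sum_eq s.2.1 u.2.1 (s.2.2.2.trans u.2.2.2.symm))⟩
  by_cases hsz : Comp.size γ = Comp.size α
  swap
  · have : IsEmpty (FundamentalSeq α (stdMonomial γ)) := ⟨fun s => hsz (by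
      have := congrArg Finsupp.degree s.2.2.2
      rw [map_sum, show (stdMonomial γ).degree = _ from degree_monomialAt _ _] at this
      simpa using this.symm)⟩
    rw [if_neg (fun h => hsz h.1), Nat.card_of_isEmpty, Nat.cast_zero]
  have hlen : (blockWord 0 γ).length = Comp.size α := (length_blockWord _ _).trans hsz
  let w : Fin (Comp.size α) → ℕ := fun t => (blockWord 0 γ)[(t : ℕ)]'(by rw [hlen]; exact t.2)
  have hw : Monotone w := by
    intro x y hxy
    rcases hxy.eq_or_lt with rfl | hxy
    · exact le_rfl
    · exact List.pairwise_iff_getElem.1 (pairwise_blockWord 0 γ) _ _ _ _ hxy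
  have hofn : List.ofFn w = blockWord 0 γ :=
    List.ext_getElem (by simp [hlen]) (by simp [w])
  have hsum : (∑ t, Finsupp.single (w t) 1 : ℕ →₀ ℕ) = stdMonomial γ := by
    rw [← List.sum_ofFn]
    rw [show (List.ofFn fun t => (Finsupp.single (w t) 1 : ℕ →₀ ℕ)) =
      (List.ofFn w).map fun x => Finsupp.single x 1 by rw [List.map_ofFn]; rfl]
    rw [hofn, sum_blockWord]
    simp only [zero_add]
    rfl
  have hstep : ∀ a b : Fin (Comp.size α), (a : ℕ) + 1 = b → (w a < w b ↔ (b : ℕ) ∈ Comp.D γ) := by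
    intro a b hab
    have := blockWord_lt_iff 0 γ a (by rw [hlen, hab]; exact b.2)
    simp only [hab] at this
    exact this
  by_cases hD : Comp.D α ⊆ Comp.D γ
  · rw [if_pos ⟨hsz, hD⟩]
    have : Nonempty (FundamentalSeq α (stdMonomial γ)) :=
      ⟨⟨w, hw, fun a b hab hb => (hstep a b hab).2 (hD hb), hsum⟩⟩
    rw [Nat.card_unique, Nat.cast_one]
  · rw [if_neg (fun h => hD h.2)]
    have : IsEmpty (FundamentalSeq α (stdMonomial γ)) := by
      refine ⟨fun s => hD fun x hx => ?_⟩
      have hsw : s.1 = w := eq_of_monotone_of_sum_eq s.2.1 hw (s.2.2.2.trans hsum.symm)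
      have hx' := mem_Ioo.1 (Comp.D_subset _ hx)
      have h1 : ((⟨x - 1, by omega⟩ : Fin (Comp.size α)) : ℕ) + 1 =
          ((⟨x, hx'.2⟩ : Fin (Comp.size α)) : ℕ) := by simp only; omega
      have h2 := s.2.2.1 ⟨x - 1, by omega⟩ ⟨x, hx'.2⟩ h1 hx
      rw [hsw] at h2
      exact (hstep _ _ h1).1 h2
    rw [Nat.card_of_isEmpty, Nat.cast_zero]

/-- The families `(R_α)` and `(F_α)` are dual to each other. -/
theorem pairing_R_F (α β : Comp) : pairing k (R k α) (F k β) = if α = β then 1 else 0 := by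
  have h1 : pairing k (R k α) (F k β) = ∑ S ∈ (Comp.D α).powerset,
      (-1 : k) ^ (Comp.D α \ S).card *
        if Comp.size α = Comp.size β ∧ Comp.D β ⊆ S then 1 else 0 := by
    rw [R, map_sum, LinearMap.sum_apply]
    refine Finset.sum_congr rfl fun S hS => ?_
    rw [map_smul, LinearMap.smul_apply, pairing_H, coeffM_F, Comp.size_ofD,
      Comp.D_ofD ((mem_powerset.1 hS).trans (Comp.D_subset α)), smul_eq_mul]
  rw [h1]
  by_cases hsz : Comp.size α = Comp.size β
  swap
  · rw [if_neg (fun h => hsz (by rw [h]))]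
    exact Finset.sum_eq_zero fun S _ => by rw [if_neg (fun h => hsz h.1), mul_zero]
  by_cases hD : Comp.D β ⊆ Comp.D α
  swap
  · rw [if_neg (fun h => hD (by rw [h]))]
    refine Finset.sum_eq_zero fun S hS => ?_
    rw [if_neg (fun h => hD (h.2.trans (mem_powerset.1 hS))), mul_zero]
  have h2 := Finset.prod_add (fun _ : ℕ => (1 : k))
    (fun i => if i ∈ Comp.D β then 0 else -1) (Comp.D α)
  have h3 : ∏ i ∈ Comp.D α, ((1 : k) + if i ∈ Comp.D β then 0 else -1) =
      if α = β then 1 else 0 := by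
    by_cases hab : α = β
    · subst hab
      rw [if_pos rfl]
      exact Finset.prod_eq_one fun i hi => by rw [if_pos hi, add_zero]
    · rw [if_neg hab]
      obtain ⟨i, hi, hi'⟩ : ∃ i ∈ Comp.D α, i ∉ Comp.D β := by
        by_contra! hcon
        exact hab (Comp.ext_D hsz (subset_antisymm hcon hD))
      exact Finset.prod_eq_zero hi (by rw [if_neg hi', add_neg_cancel])
  rw [← h3, h2]
  refine Finset.sum_congr rfl fun S hS => ?_
  rw [Finset.prod_const_one, one_mul]
  by_cases hS' : Comp.D β ⊆ S
  · rw [if_pos ⟨hsz, hS'⟩, mul_one, Finset.card_eq_sum_ones, ← Finset.prod_pow_eq_pow_sum]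
    refine Finset.prod_congr rfl fun i hi => ?_
    rw [if_neg (fun h => (mem_sdiff.1 hi).2 (hS' h)), pow_one]
  · rw [if_neg (fun h => hS' h.2), mul_zero]
    obtain ⟨i, hi, hi'⟩ := not_subset.1 hS'
    exact (Finset.prod_eq_zero (mem_sdiff.2 ⟨hD hi, hi'⟩) (by rw [if_pos hi])).symm

variable (k)

/-- The element `F_α^{\m}` of `QSym` for `α = (α₁, …, α_ℓ)`: it is `0` if `ℓ = 0` or `α_ℓ < m`,
`F_{(α₁, …, α_{ℓ-1})}` if `α_ℓ = m`, and `F_{(α₁, …, α_{ℓ-1}, α_ℓ - m)}` if `α_ℓ > m`. -/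
noncomputable def FRemove (m : ℕ+) (α : Comp) : QSym k :=
  if h : α = [] then 0
  else if α.getLast h < m then 0
  else if α.getLast h = m then F k α.dropLast
  else F k (α.dropLast ++ [α.getLast h - m])

end

end QuasiSymm

/-! The engine is the antipode identity `∑ S(f₁) f₂ = ε(f)` of `QSym`, in the form `∑_γ (-1)^|γ| F_γ
· R_{ω(γ)}^⊥ f = ε(f)` (`finsum_F_mul_perp_R_omega`), applied to `R_{(1^m)}^⊥ f` instead of `f`.

Since `(gh)^⊥ = h^⊥ g^⊥`, the term of `γ` then involves `(R_{(1^m)} R_{ω(γ)})^⊥ f`. For nonempty `γ`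
the ribbon product rule `R_mul` splits `R_{(1^m)} R_{ω(γ)}` into two ribbons, and these are
`R_{ω(α)}` for `α` the concatenation and the near-concatenation of `γ` with `(m)`. These two kinds
of `α`, together with `α = (m)` coming from `γ = ∅`, are exactly the compositions with last part at
least `m`, and for each of them `F_α^{\m} = F_γ`. Since `|α| = |γ| + m`, the sign `(-1)^m` appears
and is cancelled by the prefactor.

The antipode identity is checked one coefficient at a time. Expanding the coefficient of a monomial
`μ` and summing over `γ` first turns it into the pairing of `f` with `∑ S(H_{pack u}) H_{pack v}`
over `u + v = μ`, where `S(H_η) = (-1)^|η| ∑_{D(γ) ⊆ D(η)} R_{ω(γ)}`. By the ribbon rule `S`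
reverses products of the `H_a` and sends `H_a` to `(-1)^a E_a` (`antipodeH_cons`), so for `μ ≠ 0`
the sum vanishes because of `∑_p (-1)^p E_p H_{n-p} = 0`, a telescoping sum of hook ribbons. -/

namespace QuasiSymm

open Finset

/-! ### Near-concatenation, partial sums and `ω` -/

namespace Comp

/-- The near-concatenation `(α₁, …, α_ℓ + β₁, …, β_m)` of two compositions. -/
def near : Comp → Comp → Comp
  | [], β => β
  | [a], [] => [a]
  | [a], b :: β => (a + b) :: β
  | a :: c :: α, β => a :: near (c :: α) β

theorem near_cons (a : ℕ+) {α : Comp} (hα : α ≠ []) (β : Comp) :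
    near (a :: α) β = a :: near α β := by
  cases α with
  | nil => exact absurd rfl hα
  | cons c t => rw [near]

theorem near_singleton_append (a : ℕ+) {α : Comp} (hα : α ≠ []) (β : Comp) :
    near [a] (α ++ β) = near [a] α ++ β := by
  cases α with
  | nil => exact absurd rfl hα
  | cons c t => rfl

theorem near_ne_nil {α : Comp} (hα : α ≠ []) (β : Comp) : near α β ≠ [] := by
  rcases α with _ | ⟨a, _ | ⟨c, t⟩⟩
  · exact absurd rfl hα
  · cases β <;> simp [near]
  · simp [near]

theorem near_singleton_near (a : ℕ+) {α : Comp} (hα : α ≠ []) (β : Comp) :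
    near [a] (near α β) = near (near [a] α) β := by
  rcases α with _ | ⟨c, _ | ⟨d, t⟩⟩
  · exact absurd rfl hα
  · cases β with
    | nil => rfl
    | cons b β => simp [near, add_assoc]
  · simp [near]

theorem near_append_singleton (α : Comp) (a m : ℕ+) :
    near (α ++ [a]) [m] = α ++ [a + m] := by
  induction α with
  | nil => rfl
  | cons c t ih => rw [List.cons_append, near_cons _ (by simp), ih, List.cons_append]

theorem size_append (α β : Comp) : size (α ++ β) = size α + size β := by
  simp [size]

theorem size_near (α β : Comp) : size (near α β) = size α + size β := by
  induction α with
  | nil => simp [near]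
  | cons a t ih =>
    cases t with
    | nil => cases β <;> simp [near, add_assoc]
    | cons c t => rw [near_cons _ (by simp), size_cons, ih, size_cons a, add_assoc]

theorem size_pos {α : Comp} (hα : α ≠ []) : 0 < size α :=
  Nat.pos_of_ne_zero fun h => hα (size_eq_zero.1 h)

theorem mem_D_cons {a : ℕ+} {t : Comp} (ht : t ≠ []) {x : ℕ} :
    x ∈ D (a :: t) ↔ x = a ∨ ∃ y ∈ D t, x = a + y := by
  cases t with
  | nil => exact absurd rfl ht
  | cons b t => exact mem_D_cons_cons

theorem mem_D_append {α β : Comp} (hα : α ≠ []) (hβ : β ≠ []) {x : ℕ} :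
    x ∈ D (α ++ β) ↔ x ∈ D α ∨ x = size α ∨ ∃ y ∈ D β, x = size α + y := by
  induction α generalizing x with
  | nil => exact absurd rfl hα
  | cons a t ih =>
    rcases eq_or_ne t [] with rfl | ht
    · simp [mem_D_cons hβ]
    · rw [List.cons_append, mem_D_cons (by simp [ht]), mem_D_cons ht]
      simp only [ih ht, size_cons]
      constructor
      · rintro (h | ⟨y, h | h | ⟨z, hz, h⟩, h'⟩)
        · exact Or.inl (Or.inl h)
        · exact Or.inl (Or.inr ⟨y, h, h'⟩)
        · exact Or.inr (Or.inl (by omega))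
        · exact Or.inr (Or.inr ⟨z, hz, by omega⟩)
      · rintro ((h | ⟨y, h, h'⟩) | h | ⟨z, hz, h⟩)
        · exact Or.inl h
        · exact Or.inr ⟨y, Or.inl h, h'⟩
        · exact Or.inr ⟨size t, Or.inr (Or.inl rfl), h⟩
        · exact Or.inr ⟨size t + z, Or.inr (Or.inr ⟨z, hz, rfl⟩), by omega⟩

theorem mem_D_near_singleton {a : ℕ+} {β : Comp} {x : ℕ} :
    x ∈ D (near [a] β) ↔ ∃ y ∈ D β, x = a + y := by
  cases β with
  | nil => simp [near]
  | cons b t =>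
    rcases eq_or_ne t [] with rfl | ht
    · simp [near]
    · rw [near, mem_D_cons ht]
      simp only [mem_D_cons ht, PNat.add_coe]
      constructor
      · rintro (h | ⟨y, hy, h⟩)
        · exact ⟨b, Or.inl rfl, h⟩
        · exact ⟨b + y, Or.inr ⟨y, hy, rfl⟩, by omega⟩
      · rintro ⟨y, rfl | ⟨z, hz, rfl⟩, h⟩
        · exact Or.inl h
        · exact Or.inr ⟨z, hz, by omega⟩

theorem mem_D_near {α β : Comp} (hα : α ≠ []) {x : ℕ} :
    x ∈ D (near α β) ↔ x ∈ D α ∨ ∃ y ∈ D β, x = size α + y := by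
  induction α generalizing x with
  | nil => exact absurd rfl hα
  | cons a t ih =>
    rcases eq_or_ne t [] with rfl | ht
    · simp [mem_D_near_singleton]
    · rw [near_cons _ ht, mem_D_cons (near_ne_nil ht _), mem_D_cons ht]
      simp only [ih ht, size_cons]
      constructor
      · rintro (h | ⟨y, h | ⟨z, hz, h⟩, h'⟩)
        · exact Or.inl (Or.inl h)
        · exact Or.inl (Or.inr ⟨y, h, h'⟩)
        · exact Or.inr ⟨z, hz, by omega⟩
      · rintro ((h | ⟨y, h, h'⟩) | ⟨z, hz, h⟩)
        · exact Or.inl h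
        · exact Or.inr ⟨y, Or.inl h, h'⟩
        · exact Or.inr ⟨size t + z, Or.inr ⟨z, hz, rfl⟩, by omega⟩

theorem pos_of_mem_D {α : Comp} {x : ℕ} (h : x ∈ D α) : 0 < x := (mem_Ioo.1 (D_subset _ h)).1

theorem lt_of_mem_D {α : Comp} {x : ℕ} (h : x ∈ D α) : x < size α := (mem_Ioo.1 (D_subset _ h)).2

theorem size_reverse (α : Comp) : size α.reverse = size α := by
  simp [size]

/-- Reversal reflects the partial sums by `x ↦ |α| - x`. The bound `x < |α|` keeps the truncated
subtraction honest. -/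
theorem mem_D_reverse {α : Comp} {x : ℕ} :
    x ∈ D α.reverse ↔ x < size α ∧ size α - x ∈ D α := by
  induction α generalizing x with
  | nil => simp
  | cons a t ih =>
    rcases eq_or_ne t [] with rfl | ht
    · simp
    · rw [List.reverse_cons, mem_D_append (by simp [ht]) (by simp), size_reverse, ih,
        mem_D_cons ht]
      simp only [D_singleton, notMem_empty, false_and, exists_false, or_false, size_cons]
      have ha := a.pos
      constructor
      · rintro (⟨h, h'⟩ | rfl)
        · exact ⟨by omega, Or.inr ⟨_, h', by omega⟩⟩
        · exact ⟨by omega, Or.inl (by omega)⟩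
      · rintro ⟨h, h' | ⟨y, hy, h'⟩⟩
        · exact Or.inr (by omega)
        · have := pos_of_mem_D hy
          exact Or.inl ⟨by omega, by rwa [show size t - x = y by omega]⟩

theorem mem_D_omega {α : Comp} {x : ℕ} :
    x ∈ D (omega α) ↔ 0 < x ∧ x < size α ∧ size α - x ∉ D α := by
  rw [D_omega, mem_sdiff, mem_Ioo, mem_D_reverse]
  tauto

theorem omega_nil : omega [] = [] := size_eq_zero.1 (size_omega [])

theorem omega_ne_nil {α : Comp} (hα : α ≠ []) : omega α ≠ [] := fun h =>
  hα (size_eq_zero.1 (by rw [← size_omega, h, size_nil]))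

/-- Concatenation and near-concatenation differ only in whether the junction `|α|` is a partial sum.
Complementing exchanges the two cases, and the reflection swaps the factors. -/
theorem omega_append {α β : Comp} (hα : α ≠ []) (hβ : β ≠ []) :
    omega (α ++ β) = near (omega β) (omega α) := by
  refine ext_D (by rw [size_near, size_omega, size_omega, size_omega, size_append, add_comm]) ?_
  ext x
  rw [mem_D_near (omega_ne_nil hβ), mem_D_omega, mem_D_append hα hβ,
    mem_D_omega, size_append, size_omega]
  simp only [mem_D_omega]
  have ha := size_pos hα
  have hb := size_pos hβ
  constructor
  · rintro ⟨h1, h2, h3⟩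
    push Not at h3
    obtain ⟨h3, h4, h5⟩ := h3
    rcases lt_or_ge x (size β) with h | h
    · exact Or.inl ⟨h1, h, fun h' => h5 _ h' (by omega)⟩
    · exact Or.inr ⟨x - size β, ⟨by omega, by omega,
        by rwa [show size α - (x - size β) = size α + size β - x by omega]⟩, by omega⟩
  · rintro (⟨h1, h2, h3⟩ | ⟨y, ⟨h1, h2, h3⟩, rfl⟩)
    · refine ⟨h1, by omega, ?_⟩
      rintro (h | h | ⟨y, hy, h⟩)
      · have := lt_of_mem_D h; omega
      · omega
      · exact h3 (by rwa [show size β - x = y by omega])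
    · refine ⟨by omega, by omega, ?_⟩
      rintro (h | h | ⟨y, hy, h⟩)
      · exact h3 (by rwa [show size α - y = size α + size β - (size β + y) by omega])
      · omega
      · omega

theorem omega_near {α β : Comp} (hα : α ≠ []) (hβ : β ≠ []) :
    omega (near α β) = omega β ++ omega α := by
  refine ext_D (by rw [size_append, size_omega, size_omega, size_omega, size_near, add_comm]) ?_
  ext x
  rw [mem_D_append (omega_ne_nil hβ) (omega_ne_nil hα), mem_D_omega, mem_D_near hα,
    mem_D_omega, size_near, size_omega]
  simp only [mem_D_omega]
  have ha := size_pos hα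
  have hb := size_pos hβ
  constructor
  · rintro ⟨h1, h2, h3⟩
    push Not at h3
    obtain ⟨h4, h5⟩ := h3
    rcases lt_trichotomy x (size β) with h | h | h
    · exact Or.inl ⟨h1, h, fun h' => h5 _ h' (by omega)⟩
    · exact Or.inr (Or.inl h)
    · exact Or.inr (Or.inr ⟨x - size β, ⟨by omega, by omega,
        by rwa [show size α - (x - size β) = size α + size β - x by omega]⟩, by omega⟩)
  · rintro (⟨h1, h2, h3⟩ | rfl | ⟨y, ⟨h1, h2, h3⟩, rfl⟩)
    · refine ⟨h1, by omega, ?_⟩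
      rintro (h | ⟨y, hy, h⟩)
      · have := lt_of_mem_D h; omega
      · exact h3 (by rwa [show size β - x = y by omega])
    · refine ⟨by omega, by omega, ?_⟩
      rintro (h | ⟨y, hy, h⟩)
      · have := lt_of_mem_D h; omega
      · have := pos_of_mem_D hy; omega
    · refine ⟨by omega, by omega, ?_⟩
      rintro (h | ⟨y, hy, h⟩)
      · exact h3 (by rwa [show size α - y = size α + size β - (size β + y) by omega])
      · omega

theorem size_replicate_one (n : ℕ) : size (List.replicate n 1) = n := by
  simp [size]

theorem D_replicate_one (n : ℕ) : D (List.replicate n 1) = Finset.Ioo 0 n := by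
  induction n with
  | zero => simp
  | succ n ih =>
    rcases Nat.eq_zero_or_pos n with rfl | hn
    · simp only [zero_add, List.replicate_one, D_singleton]; rfl
    · ext x
      rw [List.replicate_succ, mem_D_cons (by simp; omega)]
      simp only [ih, mem_Ioo, PNat.one_coe]
      constructor
      · rintro (h | ⟨y, hy, h⟩) <;> omega
      · rintro ⟨h1, h2⟩
        by_cases h : x = 1
        · exact Or.inl h
        · exact Or.inr ⟨x - 1, by omega, by omega⟩

/-- The complement of the empty set is all of `{1, …, a-1}`. This is how `R_{(1^m)}` enters. -/
theorem omega_singleton (a : ℕ+) : omega [a] = List.replicate a 1 := by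
  refine ext_D (by rw [size_omega, size_replicate_one]; simp) ?_
  ext x
  rw [mem_D_omega, D_replicate_one]
  simp

theorem ofD_D (α : Comp) : ofD (size α) (D α) = α :=
  ext_D (size_ofD _ _) (D_ofD (D_subset α))

theorem ofD_ne_nil {n : ℕ} (hn : 0 < n) (S : Finset ℕ) : ofD n S ≠ [] := fun h => by
  have := size_ofD n S
  rw [h, size_nil] at this
  omega

/-- Every composition of size `n` is determined by its set of partial sums, so there are finitely
many compositions of bounded size. -/
theorem finite_size_le (N : ℕ) : {α : Comp | size α ≤ N}.Finite := by
  refine Set.Finite.of_finite_image (f := fun α : Comp => (size α, D α))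
    (Set.Finite.subset (Finset.finite_toSet (range (N + 1) ×ˢ (Finset.Ioo 0 N).powerset)) ?_) ?_
  · rintro _ ⟨α, hα, rfl⟩
    simp only [Set.mem_ofPred_eq] at hα
    simp only [coe_product, Set.mem_prod, mem_coe, mem_range, mem_powerset]
    refine ⟨by omega, fun x hx => ?_⟩
    have := mem_Ioo.1 (D_subset _ hx)
    rw [mem_Ioo]; omega
  · intro α _ β _ h
    exact ext_D (congrArg Prod.fst h) (congrArg Prod.snd h)

/-! ### Splitting off the first part in sums over sets of partial sums -/

/-- The translate `a + S` of a set of natural numbers. -/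
def shift (a : ℕ) (S : Finset ℕ) : Finset ℕ := S.map (addLeftEmbedding a)

theorem mem_shift {a : ℕ} {S : Finset ℕ} {x : ℕ} : x ∈ shift a S ↔ ∃ y ∈ S, x = a + y := by
  simp [shift, eq_comm]

theorem D_cons {a : ℕ+} {t : Comp} (ht : t ≠ []) : D (a :: t) = insert (a : ℕ) (shift a (D t)) := by
  ext x
  rw [mem_D_cons ht, mem_insert, mem_shift]

theorem D_near_singleton (a : ℕ+) (t : Comp) : D (near [a] t) = shift a (D t) := by
  ext x
  rw [mem_D_near_singleton, mem_shift]

theorem notMem_shift_D (a : ℕ) (α : Comp) : a ∉ shift a (D α) := by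
  rw [mem_shift]
  rintro ⟨y, hy, h⟩
  have := pos_of_mem_D hy
  omega

theorem ofD_insert_shift {a : ℕ+} {t : Comp} (ht : t ≠ []) {S : Finset ℕ} (hS : S ⊆ D t) :
    ofD (a + size t) (insert (a : ℕ) (shift a S)) = a :: ofD (size t) S := by
  have h : D (ofD (size t) S) = S := D_ofD (hS.trans (D_subset t))
  have hne := ofD_ne_nil (size_pos ht) S
  refine Eq.trans ?_ (ofD_D (a :: ofD (size t) S))
  rw [size_cons, size_ofD, D_cons hne, h]

theorem ofD_shift {a : ℕ+} {t : Comp} {S : Finset ℕ} (hS : S ⊆ D t) :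
    ofD (a + size t) (shift a S) = near [a] (ofD (size t) S) := by
  have h : D (ofD (size t) S) = S := D_ofD (hS.trans (D_subset t))
  refine Eq.trans ?_ (ofD_D (near [a] (ofD (size t) S)))
  rw [size_near, size_ofD, D_near_singleton, h]
  simp

theorem sum_powerset_shift {M : Type*} [AddCommMonoid M] (a : ℕ) (A : Finset ℕ)
    (φ : Finset ℕ → M) :
    ∑ S ∈ (shift a A).powerset, φ S = ∑ S ∈ A.powerset, φ (shift a S) := by
  rw [shift, map_eq_image, powerset_image, sum_image]
  · simp only [shift, map_eq_image]
  · exact (image_injective (addLeftEmbedding a).injective).injOn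

/-- Subsets of `D(a, t)` come in pairs, with and without the element `a`. The corresponding
compositions are `a` put in front of, or merged into, a composition coarser than or equal to `t`. -/
theorem sum_powerset_D_cons {M : Type*} [AddCommMonoid M] {a : ℕ+} {t : Comp} (ht : t ≠ [])
    (φ : Finset ℕ → M) :
    ∑ S ∈ (D (a :: t)).powerset, φ S =
      ∑ S ∈ (D t).powerset, (φ (insert (a : ℕ) (shift a S)) + φ (shift a S)) := by
  rw [D_cons ht, sum_powerset_insert (notMem_shift_D _ _), sum_powerset_shift,
    sum_powerset_shift _ _ fun S => φ (insert (a : ℕ) S), ← sum_add_distrib]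
  exact sum_congr rfl fun _ _ => add_comm _ _

end Comp

/-! ### The ribbon product rule -/

section

variable {k : Type*} [CommRing k]

theorem R_nil : R k [] = 1 := by
  have h : Comp.ofD 0 ∅ = [] := Comp.size_eq_zero.1 (Comp.size_ofD 0 ∅)
  rw [R, Comp.D_nil, powerset_empty, sum_singleton, Comp.size_nil, h, sdiff_empty, card_empty,
    pow_zero, one_smul]
  rfl

theorem R_singleton (a : ℕ+) : R k [a] = H k [a] := by
  have h := Comp.ofD_D [a]
  rw [Comp.D_singleton] at h
  rw [R, Comp.D_singleton, powerset_empty, sum_singleton, h]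
  simp

/-- In the expansion of `R_{(a, t)}`, the subsets containing `a` give `H_a R_t`. Those omitting `a`
carry one more sign and cancel against the expansion of the near-concatenation. -/
theorem H_mul_R {a : ℕ+} {t : Comp} (ht : t ≠ []) :
    H k [a] * R k t = R k (a :: t) + R k (Comp.near [a] t) := by
  rw [R, R, R, Comp.D_near_singleton, Comp.sum_powerset_shift, Comp.sum_powerset_D_cons ht,
    mul_sum, ← sum_add_distrib]
  refine sum_congr rfl fun S hS => ?_
  rw [mem_powerset] at hS
  have hn : (a : ℕ) ∉ Comp.shift a S := fun h =>
    Comp.notMem_shift_D a t (map_subset_map.2 hS h)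
  have c1 : (insert (a : ℕ) (Comp.shift a (Comp.D t)) \ insert (a : ℕ) (Comp.shift a S)).card =
      (Comp.D t \ S).card := by
    rw [insert_sdiff_insert, sdiff_insert_of_notMem (Comp.notMem_shift_D a t), Comp.shift,
      Comp.shift, ← Finset.map_sdiff, card_map]
  have c2 : (Comp.shift a (Comp.D t) \ Comp.shift a S).card = (Comp.D t \ S).card := by
    rw [Comp.shift, Comp.shift, ← Finset.map_sdiff, card_map]
  have c3 : (insert (a : ℕ) (Comp.shift a (Comp.D t)) \ Comp.shift a S).card =
      (Comp.D t \ S).card + 1 := by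
    rw [insert_sdiff_of_notMem _ hn, card_insert_of_notMem
      (fun h => Comp.notMem_shift_D a t (mem_sdiff.1 h).1), c2]
  have hs : Comp.size (Comp.near [a] t) = a + Comp.size t := by
    rw [Comp.size_near]; simp
  rw [Comp.D_cons ht, c1, c2, c3, hs, Comp.size_cons, Comp.ofD_insert_shift ht hS,
    mul_smul_comm, H_mul, pow_succ, mul_neg_one, neg_smul, neg_add_cancel_right]
  rfl

/-- The product rule for the ribbon basis. -/
theorem R_mul {α β : Comp} (hα : α ≠ []) (hβ : β ≠ []) :
    R k α * R k β = R k (α ++ β) + R k (Comp.near α β) := by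
  -- Induction on the length, because the hypothesis is needed for `near [a] t` as well as for `t`;
  -- both have length `n`.
  induction hn : α.length generalizing α with
  | zero => exact absurd (List.length_eq_zero_iff.1 hn) hα
  | succ n ih =>
    rcases α with _ | ⟨a, t⟩
    · exact absurd rfl hα
    rcases eq_or_ne t [] with rfl | ht
    · rw [R_singleton, H_mul_R hβ]; rfl
    · have hlen : t.length = n := by simpa using hn
      have hlen' : (Comp.near [a] t).length = n := by
        rw [← hlen]
        cases t with
        | nil => exact absurd rfl ht
        | cons b t => rfl
      have h1 := ih ht hlen
      have h2 := ih (Comp.near_ne_nil (List.cons_ne_nil a []) t) hlen'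
      have e1 : R k (a :: t) = H k [a] * R k t - R k (Comp.near [a] t) := by
        rw [H_mul_R ht, add_sub_cancel_right]
      have e2 : R k (a :: (t ++ β)) = H k [a] * R k (t ++ β) - R k (Comp.near [a] (t ++ β)) := by
        rw [H_mul_R (by simp [ht]), add_sub_cancel_right]
      have e3 : R k (a :: Comp.near t β) =
          H k [a] * R k (Comp.near t β) - R k (Comp.near [a] (Comp.near t β)) := by
        rw [H_mul_R (Comp.near_ne_nil ht β), add_sub_cancel_right]
      rw [List.cons_append, Comp.near_cons a ht, e1, e2, e3, sub_mul, mul_assoc, h1, h2,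
        Comp.near_singleton_append a ht, Comp.near_singleton_near a ht, mul_add]
      abel

/-! ### Elementary and complete generators -/

variable (k)

/-- The element `E_n = R_{(1^n)}` of `NSym`. -/
noncomputable def E (n : ℕ) : NSym k := R k (List.replicate n 1)

/-- The element `H_n` of `NSym`, with `H_0 = 1`. -/
noncomputable def Hnat (n : ℕ) : NSym k := if h : 0 < n then H k [n.toPNat h] else 1

variable {k}

theorem E_zero : E k 0 = 1 := R_nil

theorem Hnat_zero : Hnat k 0 = 1 := by simp [Hnat]

theorem Hnat_of_pos {n : ℕ} (h : 0 < n) : Hnat k n = R k [n.toPNat h] := by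
  rw [Hnat, dif_pos h, R_singleton]

theorem near_replicate_one (p : ℕ) (a : ℕ+) :
    Comp.near (List.replicate (p + 1) 1) [a] = List.replicate p 1 ++ [1 + a] := by
  rw [List.replicate_succ', Comp.near_append_singleton]

/-- For `0 < p < n` the product `E_p H_{n-p}` is the sum of the hook ribbons of `(1^p, n-p)` and
`(1^{p-1}, n-p+1)`, so the alternating sum telescopes to its last hook. -/
theorem sum_range_E_mul_Hnat {n q : ℕ} (hq : q < n) :
    ∑ p ∈ range (q + 1), (-1 : k) ^ p • (E k p * Hnat k (n - p)) =
      (-1 : k) ^ q • R k (List.replicate q 1 ++ [(n - q).toPNat (by omega)]) := by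
  induction q with
  | zero =>
    rw [zero_add, sum_range_one, E_zero, one_mul, Hnat_of_pos (by omega)]
    rfl
  | succ q ih =>
    rw [sum_range_succ, ih (by omega), Hnat_of_pos (by omega), E,
      R_mul (by simp [List.replicate_succ]) (by simp), near_replicate_one]
    have : 1 + (n - (q + 1)).toPNat (by omega) = (n - q).toPNat (by omega) :=
      PNat.coe_injective (show 1 + (n - (q + 1)) = n - q by omega)
    rw [this, pow_succ, mul_neg_one, neg_smul, neg_smul, smul_add]
    abel

/-- The relation between the elementary and the complete generators of `NSym`. -/
theorem sum_antidiagonal_E_mul_Hnat {n : ℕ} (hn : 0 < n) :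
    ∑ p ∈ antidiagonal n, (-1 : k) ^ p.1 • (E k p.1 * Hnat k p.2) = 0 := by
  obtain ⟨q, rfl⟩ : ∃ q, n = q + 1 := ⟨n - 1, by omega⟩
  have h1 : (q + 1 - q).toPNat (by omega) = 1 :=
    PNat.coe_injective (show q + 1 - q = 1 by omega)
  -- The remaining hook is `(1^q, 1) = (1^{q+1})`, which cancels the last term `E_{q+1} H_0`.
  rw [Nat.sum_antidiagonal_eq_sum_range_succ_mk, Nat.succ_eq_add_one, sum_range_succ,
    sum_range_E_mul_Hnat (Nat.lt_succ_self q), h1, ← List.replicate_succ', Nat.sub_self,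
    Hnat_zero, mul_one, pow_succ, mul_neg_one, neg_smul, E, add_neg_cancel]

/-! ### The antipode on the complete basis -/

variable (k)

/-- The image of `H_η` under the antipode of `NSym`. -/
noncomputable def antipodeH (η : Comp) : NSym k :=
  (-1 : k) ^ Comp.size η •
    ∑ S ∈ (Comp.D η).powerset, R k (Comp.omega (Comp.ofD (Comp.size η) S))

variable {k}

theorem antipodeH_nil : antipodeH k [] = 1 := by
  have h : Comp.ofD 0 ∅ = [] := Comp.size_eq_zero.1 (Comp.size_ofD 0 ∅)
  simp only [antipodeH, Comp.D_nil, powerset_empty, sum_singleton, Comp.size_nil, h,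
    Comp.omega_nil, R_nil, pow_zero, one_smul]

/-- For each `β` with `D(β) ⊆ D(t)`, putting `a` in front of `β` and merging `a` into `β` become,
under `ω`, the near-concatenation and the concatenation of `ω(β)` with `(1^a)`. Together their
ribbons make up `R_{ω(β)} E_a`. -/
theorem antipodeH_cons (a : ℕ+) (t : Comp) :
    antipodeH k (a :: t) = antipodeH k t * (-1 : k) ^ (a : ℕ) • E k a := by
  rcases eq_or_ne t [] with rfl | ht
  · have h := Comp.ofD_D [a]
    rw [Comp.D_singleton] at h
    rw [antipodeH_nil, one_mul, antipodeH, Comp.D_singleton, powerset_empty, sum_singleton, h,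
      Comp.omega_singleton, E]
    simp
  · have key : ∑ S ∈ (Comp.D (a :: t)).powerset,
        R k (Comp.omega (Comp.ofD (Comp.size (a :: t)) S)) =
        (∑ S ∈ (Comp.D t).powerset, R k (Comp.omega (Comp.ofD (Comp.size t) S))) * E k a := by
      rw [Comp.sum_powerset_D_cons ht, sum_mul, Comp.size_cons]
      refine sum_congr rfl fun S hS => ?_
      have hne := Comp.ofD_ne_nil (Comp.size_pos ht) S
      rw [mem_powerset] at hS
      rw [Comp.ofD_insert_shift ht hS, Comp.ofD_shift hS,
        ← List.singleton_append, Comp.omega_append (by simp) hne, Comp.omega_near (by simp) hne,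
        Comp.omega_singleton, E, R_mul (Comp.omega_ne_nil hne) (by simp), add_comm]
    rw [antipodeH, antipodeH, key, smul_mul_assoc, mul_smul_comm, smul_smul, ← pow_add,
      Comp.size_cons, add_comm (a : ℕ)]

end

/-! ### Splitting off the smallest variable; the antipode identity in `NSym` -/

theorem pack_single_add {σ : Type*} [LinearOrder σ] {i : σ} {v : σ →₀ ℕ}
    (hv : ∀ j ∈ v.support, i < j) {q : ℕ} (hq : 0 < q) :
    pack (Finsupp.single i q + v) = q.toPNat hq :: pack v := by
  have hi : i ∉ v.support := fun h => lt_irrefl _ (hv i h)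
  have hvi : v i = 0 := Finsupp.notMem_support_iff.1 hi
  have hsupp : (Finsupp.single i q + v).support = cons i v.support hi := by
    ext j
    rw [mem_cons, Finsupp.mem_support_iff, Finsupp.mem_support_iff, Finsupp.add_apply]
    by_cases hj : j = i
    · subst hj; simp; omega
    · rw [Finsupp.single_eq_of_ne hj]; simp [hj]
  rw [pack, hsupp, sort_cons _ (fun b hb => (hv b hb).le), List.map_cons, pack]
  congr 1
  · rw [Finsupp.add_apply, Finsupp.single_eq_same, hvi, add_zero]
    refine PNat.coe_injective ?_
    rw [Nat.toPNat'_coe, if_pos hq]; rfl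
  · refine List.map_congr_left fun j hj => ?_
    have hj' : j ≠ i := fun h => hi (h ▸ (Finset.mem_sort _).1 hj)
    rw [Finsupp.add_apply, Finsupp.single_eq_of_ne hj', zero_add]

/-- The exponent of the variable `i` is split independently of the others; erasing `i` and
evaluating at `i` give the bijection. -/
theorem sum_antidiagonal_single_add {σ M : Type*} [DecidableEq σ] [AddCommMonoid M] {i : σ}
    {μ : σ →₀ ℕ} (hi : μ i = 0) (a : ℕ) (φ : (σ →₀ ℕ) × (σ →₀ ℕ) → M) :
    ∑ p ∈ antidiagonal (Finsupp.single i a + μ), φ p =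
      ∑ q ∈ antidiagonal μ, ∑ p ∈ antidiagonal a,
        φ (Finsupp.single i p.1 + q.1, Finsupp.single i p.2 + q.2) := by
  refine Eq.trans ?_ (sum_product' (antidiagonal μ) (antidiagonal a) fun q p =>
    φ (Finsupp.single i p.1 + q.1, Finsupp.single i p.2 + q.2))
  refine sum_bij' (fun p _ => ((p.1.erase i, p.2.erase i), (p.1 i, p.2 i)))
    (fun x _ => (Finsupp.single i x.2.1 + x.1.1, Finsupp.single i x.2.2 + x.1.2)) ?_ ?_ ?_ ?_ ?_
  · rintro ⟨u, v⟩ h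
    rw [HasAntidiagonal.mem_antidiagonal] at h
    simp only [mem_product, HasAntidiagonal.mem_antidiagonal]
    refine ⟨?_, ?_⟩
    · rw [← Finsupp.erase_add, h, Finsupp.erase_add, Finsupp.erase_single, zero_add,
        Finsupp.erase_of_notMem_support (by simpa using hi)]
    · have := DFunLike.congr_fun h i
      simpa [hi] using this
  · rintro ⟨⟨u, v⟩, b, c⟩ h
    simp only [mem_product, HasAntidiagonal.mem_antidiagonal] at h ⊢
    rw [← h.1, ← h.2, Finsupp.single_add]
    abel
  · rintro ⟨u, v⟩ h
    exact Prod.ext (Finsupp.single_add_erase i u) (Finsupp.single_add_erase i v)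
  · rintro ⟨⟨u, v⟩, b, c⟩ h
    simp only [mem_product, HasAntidiagonal.mem_antidiagonal] at h
    have h0 := DFunLike.congr_fun h.1 i
    rw [hi, Finsupp.add_apply, Nat.add_eq_zero_iff] at h0
    simp only [Finsupp.erase_add, Finsupp.erase_single, zero_add, Finsupp.add_apply,
      Finsupp.single_eq_same, h0.1, h0.2, add_zero]
    rw [Finsupp.erase_of_notMem_support (by simpa using h0.1),
      Finsupp.erase_of_notMem_support (by simpa using h0.2)]
  · rintro ⟨u, v⟩ h
    simp only [Finsupp.single_add_erase]

section

variable {k : Type*} [CommRing k]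

theorem H_pack_single_add {i : ℕ} {v : ℕ →₀ ℕ} (hv : ∀ j ∈ v.support, i < j) (q : ℕ) :
    H k (pack (Finsupp.single i q + v)) = Hnat k q * H k (pack v) := by
  rcases Nat.eq_zero_or_pos q with rfl | hq
  · rw [Finsupp.single_zero, zero_add, Hnat_zero, one_mul]
  · rw [pack_single_add hv hq, Hnat_of_pos hq, R_singleton, H_mul, List.singleton_append]

theorem antipodeH_pack_single_add {i : ℕ} {u : ℕ →₀ ℕ} (hu : ∀ j ∈ u.support, i < j) (p : ℕ) :
    antipodeH k (pack (Finsupp.single i p + u)) =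
      antipodeH k (pack u) * (-1 : k) ^ p • E k p := by
  rcases Nat.eq_zero_or_pos p with rfl | hp
  · rw [Finsupp.single_zero, zero_add, E_zero, pow_zero, one_smul, mul_one]
  · rw [pack_single_add hu hp, antipodeH_cons]
    rfl

/-- The antipode identity of `NSym`, applied to the basis element `H_{pack μ}`. -/
theorem sum_antidiagonal_antipodeH_mul_H {μ : ℕ →₀ ℕ} (hμ : μ ≠ 0) :
    ∑ p ∈ antidiagonal μ, antipodeH k (pack p.1) * H k (pack p.2) = 0 := by
  have hne : μ.support.Nonempty := Finsupp.support_nonempty_iff.2 hμ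
  -- For the smallest variable the factor `H` stands first in `H_{pack v}`, while the factor `E`
  -- stands last in the order-reversing antipode of `H_{pack u}`. The two meet in the middle, where
  -- `sum_antidiagonal_E_mul_Hnat` applies.
  set i := μ.support.min' hne with hidef
  have hi : 0 < μ i := Nat.pos_of_ne_zero (Finsupp.mem_support_iff.1 (min'_mem _ hne))
  have hlt : ∀ j ∈ (μ.erase i).support, i < j := by
    intro j hj
    rw [Finsupp.support_erase, mem_erase] at hj
    exact lt_of_le_of_ne (min'_le _ _ hj.2) (Ne.symm hj.1)
  rw [← Finsupp.single_add_erase i μ, sum_antidiagonal_single_add (Finsupp.erase_same)]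
  refine sum_eq_zero fun q hq => ?_
  rw [HasAntidiagonal.mem_antidiagonal] at hq
  have h1 : ∀ j ∈ q.1.support, i < j := fun j hj => hlt j (by
    rw [Finsupp.mem_support_iff] at hj ⊢
    rw [← hq, Finsupp.add_apply]; omega)
  have h2 : ∀ j ∈ q.2.support, i < j := fun j hj => hlt j (by
    rw [Finsupp.mem_support_iff] at hj ⊢
    rw [← hq, Finsupp.add_apply]; omega)
  have h3 : ∀ p ∈ antidiagonal (μ i), antipodeH k (pack (Finsupp.single i p.1 + q.1)) *
      H k (pack (Finsupp.single i p.2 + q.2)) =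
      antipodeH k (pack q.1) * ((-1 : k) ^ p.1 • (E k p.1 * Hnat k p.2)) * H k (pack q.2) := by
    intro p _
    rw [H_pack_single_add h2, antipodeH_pack_single_add h1, ← smul_mul_assoc]
    simp only [mul_assoc]
  rw [sum_congr rfl h3, ← sum_mul, ← mul_sum, sum_antidiagonal_E_mul_Hnat hi, mul_zero, zero_mul]

/-! ### Adjoint operators and the antipode identity in `QSym` -/

theorem coeff_perp (g : NSym k) (f : QSym k) (μ : ℕ →₀ ℕ) :
    MvPowerSeries.coeff μ (perp g f : MvPowerSeries ℕ k) = pairing k (g * H k (pack μ)) f := rfl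

theorem perp_add (g h : NSym k) (f : QSym k) : perp (g + h) f = perp g f + perp h f :=
  ext_pairing fun a => by
    rw [map_add, pairing_perp, pairing_perp, pairing_perp, add_mul, map_add, LinearMap.add_apply]

theorem perp_mul (g h : NSym k) (f : QSym k) : perp (g * h) f = perp h (perp g f) :=
  ext_pairing fun a => by
    rw [pairing_perp, pairing_perp, pairing_perp, mul_assoc]

theorem perp_one (f : QSym k) : perp 1 f = f :=
  ext_pairing fun a => by rw [pairing_perp, one_mul]

/-- `R_α` is a combination of `H_β` with `|β| = |α|`, so only coefficients of `f` in degree at least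
`|α|` are read off. -/
theorem perp_R_eq_zero {f : QSym k} {N : ℕ}
    (hN : ∀ μ : ℕ →₀ ℕ, N < μ.degree → MvPowerSeries.coeff μ (f : MvPowerSeries ℕ k) = 0)
    {α : Comp} (hα : N < Comp.size α) : perp (R k α) f = 0 := by
  refine Subtype.ext (MvPowerSeries.ext fun μ => ?_)
  rw [coeff_perp, R, sum_mul, map_sum, LinearMap.sum_apply]
  refine sum_eq_zero fun S _ => ?_
  rw [smul_mul_assoc, H_mul, map_smul, LinearMap.smul_apply, pairing_H]
  have : coeffM k (Comp.ofD (Comp.size α) S ++ pack μ) f = 0 := hN _ (by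
    rw [stdMonomial, degree_monomialAt, Comp.size_append, Comp.size_ofD]
    omega)
  rw [this, smul_zero]

theorem finite_perp_R_omega (f : QSym k) : {α : Comp | perp (R k α.omega) f ≠ 0}.Finite := by
  obtain ⟨N, hN⟩ := f.2.1
  refine (Comp.finite_size_le N).subset fun α hα => ?_
  by_contra h
  exact hα (perp_R_eq_zero hN (by rw [Comp.size_omega]; simpa using h))

/-- `M_η` occurs in `F_γ`, with coefficient 1, exactly when `|γ| = |η|` and `D(γ) ⊆ D(η)`; such `γ`
correspond to the subsets `S = D(γ)` of `D(η)`. -/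
theorem sum_coeffM_F_smul_R_omega {s : Finset Comp} {η : Comp}
    (hs : ∀ γ : Comp, Comp.size γ = Comp.size η → γ ∈ s) :
    ∑ γ ∈ s, ((-1 : k) ^ Comp.size γ * coeffM k η (F k γ)) • R k γ.omega = antipodeH k η := by
  rw [antipodeH, smul_sum]
  symm
  refine sum_of_injOn (fun S => Comp.ofD (Comp.size η) S) ?_ ?_ ?_ ?_
  · intro S hS T hT h
    simp only [coe_powerset, Set.mem_preimage, Set.mem_powerset_iff, coe_subset] at hS hT
    rw [← Comp.D_ofD (hS.trans (Comp.D_subset η)), ← Comp.D_ofD (hT.trans (Comp.D_subset η))]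
    exact congrArg Comp.D h
  · intro S _
    exact hs _ (Comp.size_ofD _ _)
  · intro γ _ hγ
    rw [coeffM_F, if_neg, mul_zero, zero_smul]
    rintro ⟨h1, h2⟩
    exact hγ ⟨Comp.D γ, by simpa using h2, by simp only [h1, Comp.ofD_D]⟩
  · intro S hS
    rw [mem_powerset] at hS
    rw [coeffM_F, Comp.size_ofD, Comp.D_ofD (hS.trans (Comp.D_subset η)), if_pos ⟨rfl, hS⟩,
      mul_one]

theorem neg_one_pow_mul (n : ℕ) (f : QSym k) : (-1 : QSym k) ^ n * f = (-1 : k) ^ n • f := by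
  rw [Algebra.smul_def, map_pow, map_neg, map_one]

theorem coeff_sum_F_mul_perp_R_omega (f : QSym k) {s : Finset Comp} {μ : ℕ →₀ ℕ}
    (hs : ∀ γ : Comp, Comp.size γ ≤ μ.degree → γ ∈ s) :
    MvPowerSeries.coeff μ ((∑ γ ∈ s, (-1 : QSym k) ^ Comp.size γ *
      (F k γ * perp (R k γ.omega) f) : QSym k) : MvPowerSeries ℕ k) =
      pairing k (∑ p ∈ antidiagonal μ, antipodeH k (pack p.1) * H k (pack p.2)) f := by
  have h1 : ∀ γ : Comp, MvPowerSeries.coeff μ (((-1 : QSym k) ^ Comp.size γ *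
      (F k γ * perp (R k γ.omega) f) : QSym k) : MvPowerSeries ℕ k) =
      ∑ p ∈ antidiagonal μ, pairing k (((-1 : k) ^ Comp.size γ * coeffM k (pack p.1) (F k γ)) •
        R k γ.omega * H k (pack p.2)) f := by
    intro γ
    rw [neg_one_pow_mul, Subalgebra.coe_smul, Subalgebra.coe_mul, map_smul, MvPowerSeries.coeff_mul,
      smul_sum]
    refine sum_congr rfl fun p _ => ?_
    rw [coeff_perp, coeff_eq_coeffM, smul_mul_assoc, map_smul, LinearMap.smul_apply, smul_eq_mul,
      smul_eq_mul, mul_assoc]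
  rw [AddSubmonoidClass.coe_finsetSum, map_sum, sum_congr rfl fun γ _ => h1 γ, sum_comm, map_sum,
    LinearMap.sum_apply]
  refine sum_congr rfl fun p hp => ?_
  rw [HasAntidiagonal.mem_antidiagonal] at hp
  rw [← LinearMap.sum_apply, ← map_sum, ← sum_mul, sum_coeffM_F_smul_R_omega]
  intro γ hγ
  refine hs γ ?_
  rw [hγ, size_pack, ← hp, map_add]
  exact Nat.le_add_right _ _

/-- The antipode identity `∑ S(f₁) f₂ = ε(f)` of `QSym`. -/
theorem finsum_F_mul_perp_R_omega (f : QSym k) :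
    ∑ᶠ γ : Comp, (-1 : QSym k) ^ Comp.size γ * (F k γ * perp (R k γ.omega) f) =
      algebraMap k (QSym k) (counit k f) := by
  refine Subtype.ext (MvPowerSeries.ext fun μ => ?_)
  -- The first set contains the support of the sum; the second makes each inner sum over `γ`
  -- complete, as `coeff_sum_F_mul_perp_R_omega` requires.
  have hfin := (finite_perp_R_omega f).union (Comp.finite_size_le μ.degree)
  rw [finsum_eq_sum_of_support_subset (s := hfin.toFinset) _ (by
      intro γ hγ
      rw [Set.Finite.coe_toFinset]
      refine Or.inl fun h => hγ ?_
      simp only [h, mul_zero]),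
    coeff_sum_F_mul_perp_R_omega f (fun γ hγ => by
      rw [Set.Finite.mem_toFinset]; exact Or.inr hγ)]
  change _ = MvPowerSeries.coeff μ (algebraMap k (MvPowerSeries ℕ k) (counit k f))
  rw [MvPowerSeries.algebraMap_apply, MvPowerSeries.coeff_C]
  by_cases hμ : μ = 0
  · subst hμ
    rw [if_pos rfl]
    have h0 : pack (0 : ℕ →₀ ℕ) = [] := by simp [pack]
    simp only [Finsupp.antidiagonal_zero, sum_singleton, h0, antipodeH_nil, one_mul, pairing_H]
    change coeffM k [] f = MvPowerSeries.coeff 0 (f : MvPowerSeries ℕ k)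
    rw [coeff_eq_coeffM, h0]
  · rw [if_neg hμ, sum_antidiagonal_antipodeH_mul_H hμ, map_zero, LinearMap.zero_apply]

/-! ### Removing `m` from the last part and reindexing -/

theorem FRemove_append_singleton (m : ℕ+) (γ : Comp) : FRemove k m (γ ++ [m]) = F k γ := by
  simp [FRemove]

theorem FRemove_near_singleton (m : ℕ+) {γ : Comp} (hγ : γ ≠ []) :
    FRemove k m (Comp.near γ [m]) = F k γ := by
  obtain ⟨t, a, rfl⟩ := List.eq_nil_or_concat' γ |>.resolve_left hγ
  rw [Comp.near_append_singleton]
  have h1 : ¬ a + m < m := fun h => by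
    have : (a : ℕ) + m < m := h
    omega
  have h2 : a + m ≠ m := fun h => by
    have := congrArg PNat.val h
    have h' : (a : ℕ) + m = m := this
    have := a.pos
    omega
  simp [FRemove, h1, h2, PNat.add_sub]

theorem FRemove_ne_zero {m : ℕ+} {α : Comp} (h : FRemove k m α ≠ 0) :
    (∃ γ, α = γ ++ [m]) ∨ ∃ γ, γ ≠ [] ∧ α = Comp.near γ [m] := by
  rcases List.eq_nil_or_concat' α with rfl | ⟨t, a, rfl⟩
  · simp [FRemove] at h
  · rcases lt_trichotomy a m with h1 | rfl | h1
    · simp [FRemove, h1] at h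
    · exact Or.inl ⟨t, rfl⟩
    · refine Or.inr ⟨t ++ [a - m], by simp, ?_⟩
      rw [Comp.near_append_singleton, add_comm, PNat.add_sub_of_lt h1]

theorem near_singleton_injOn (m : ℕ+) :
    Set.InjOn (fun γ => Comp.near γ [m]) {γ : Comp | γ ≠ []} := by
  intro α hα β hβ h
  obtain ⟨s, a, rfl⟩ := List.eq_nil_or_concat' α |>.resolve_left hα
  obtain ⟨t, b, rfl⟩ := List.eq_nil_or_concat' β |>.resolve_left hβ
  have h' : s ++ [a + m] = t ++ [b + m] := by
    rw [← Comp.near_append_singleton, ← Comp.near_append_singleton]; exact h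
  obtain ⟨rfl, h2⟩ := List.append_inj' h' rfl
  rw [add_right_cancel (List.singleton_inj.1 h2)]

/-- The last part is `m` on one side and larger than `m` on the other. Excluding `γ = []` matters:
its near-concatenation with `(m)` is `(m)`, which is already counted as a concatenation. -/
theorem disjoint_range_append_image_near (m : ℕ+) :
    Disjoint (Set.range fun γ : Comp => γ ++ [m])
      ((fun γ => Comp.near γ [m]) '' {γ : Comp | γ ≠ []}) := by
  rw [Set.disjoint_left]
  rintro _ ⟨s, rfl⟩ ⟨β, hβ, h⟩
  obtain ⟨t, b, rfl⟩ := List.eq_nil_or_concat' β |>.resolve_left hβ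
  simp only [Comp.near_append_singleton] at h
  obtain ⟨-, h⟩ := List.append_inj' h rfl
  simp only [List.cons.injEq, and_true] at h
  have h' : (b : ℕ) + m = m := congrArg PNat.val h
  have := b.pos
  omega

/-- A sum supported on the concatenations of compositions with `(m)` and the near-concatenations
of nonempty compositions with `(m)`. -/
theorem finsum_eq_add_of_support_subset {M : Type*} [AddCommMonoid M] (m : ℕ+) (G : Comp → M)
    (hfin : (Function.support G).Finite)
    (hG : ∀ α, G α ≠ 0 → (∃ γ, α = γ ++ [m]) ∨ ∃ γ, γ ≠ [] ∧ α = Comp.near γ [m]) :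
    ∑ᶠ α, G α = ∑ᶠ γ, (G (γ ++ [m]) + if γ = [] then 0 else G (Comp.near γ [m])) := by
  have hinj : Function.Injective fun γ : Comp => γ ++ [m] := List.append_left_injective [m]
  have hsub : Function.support G ⊆ (Set.range fun γ : Comp => γ ++ [m]) ∪
      ((fun γ => Comp.near γ [m]) '' {γ : Comp | γ ≠ []}) := by
    intro α hα
    rcases hG α hα with ⟨γ, rfl⟩ | ⟨γ, hγ, rfl⟩
    · exact Or.inl ⟨γ, rfl⟩
    · exact Or.inr ⟨γ, hγ, rfl⟩
  have h2 : ∑ᶠ γ ∈ {γ : Comp | γ ≠ []}, G (Comp.near γ [m]) =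
      ∑ᶠ γ, if γ = [] then 0 else G (Comp.near γ [m]) := by
    refine finsum_congr fun γ => ?_
    rw [finsum_eq_if]
    by_cases h : γ = [] <;> simp [h]
  rw [← finsum_mem_univ, ← finsum_mem_inter_support, Set.univ_inter,
    ← Set.inter_eq_right.2 hsub, finsum_mem_inter_support,
    finsum_mem_union' (disjoint_range_append_image_near m) (hfin.inter_of_right _)
      (hfin.inter_of_right _), finsum_mem_range hinj, finsum_mem_image (near_singleton_injOn m), h2,
    finsum_add_distrib]
  · exact hfin.preimage hinj.injOn
  · refine (Set.Finite.of_finite_image (hfin.subset ?_) ((near_singleton_injOn m).mono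
      (s₁ := {γ : Comp | γ ≠ [] ∧ G (Comp.near γ [m]) ≠ 0}) fun γ h => h.1)).subset ?_
    · rintro _ ⟨γ, hγ, rfl⟩
      exact hγ.2
    · intro γ hγ
      by_cases h : γ = []
      · simp [h] at hγ
      · exact ⟨h, by simpa [h] using hγ⟩

/-- `ω` reverses the order, so `(m)` attached at the end becomes the left factor `R_{(1^m)}`, which
is the factor whose adjoint acts on `f` first. -/
theorem R_omega_append_add_R_omega_near (m : ℕ+) {γ : Comp} (hγ : γ ≠ []) :
    R k (γ ++ [m]).omega + R k (Comp.near γ [m]).omega =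
      R k (List.replicate m 1) * R k γ.omega := by
  rw [Comp.omega_append hγ (by simp), Comp.omega_near hγ (by simp), Comp.omega_singleton,
    R_mul (by simp) (Comp.omega_ne_nil hγ), add_comm]

end

end QuasiSymm

/-- Removing `m` from the last part: for `f ∈ QSym` and `m ≥ 1`, only finitely many compositions
`α` satisfy `R_{ω(α)}^⊥ f ≠ 0`, and
`(-1)^m ∑_α (-1)^{|α|} F_α^{\m} R_{ω(α)}^⊥ f = ε(R_{(1^m)}^⊥ f)`. -/
theorem mainTheorem10 (k : Type*) [CommRing k] (f : QuasiSymm.QSym k) (m : ℕ+) :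
    {α : QuasiSymm.Comp | QuasiSymm.perp (QuasiSymm.R k α.omega) f ≠ 0}.Finite ∧
    (-1) ^ (m : ℕ) * ∑ᶠ α : QuasiSymm.Comp,
        (-1) ^ α.size *
          (QuasiSymm.FRemove k m α * QuasiSymm.perp (QuasiSymm.R k α.omega) f) =
      algebraMap k (QuasiSymm.QSym k)
        (QuasiSymm.counit k (QuasiSymm.perp (QuasiSymm.R k (List.replicate m 1)) f)) := by
  have hfin := QuasiSymm.finite_perp_R_omega f
  refine ⟨hfin, ?_⟩
  -- The right side becomes the antipode sum of `R_{(1^m)}^⊥ f`; the left side is grouped by the `γ`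
  -- that remains after `m` is removed.
  rw [← QuasiSymm.finsum_F_mul_perp_R_omega, QuasiSymm.finsum_eq_add_of_support_subset m]
  · have key : ∀ γ : QuasiSymm.Comp,
        ((-1 : QuasiSymm.QSym k) ^ QuasiSymm.Comp.size (γ ++ [m]) *
          (QuasiSymm.FRemove k m (γ ++ [m]) *
            QuasiSymm.perp (QuasiSymm.R k (QuasiSymm.Comp.omega (γ ++ [m]))) f) +
          if γ = [] then 0 else (-1 : QuasiSymm.QSym k) ^ (QuasiSymm.Comp.near γ [m]).size *
          (QuasiSymm.FRemove k m (QuasiSymm.Comp.near γ [m]) *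
            QuasiSymm.perp (QuasiSymm.R k (QuasiSymm.Comp.near γ [m]).omega) f)) =
        (-1) ^ (m : ℕ) * ((-1) ^ γ.size * (QuasiSymm.F k γ *
          QuasiSymm.perp (QuasiSymm.R k γ.omega)
            (QuasiSymm.perp (QuasiSymm.R k (List.replicate m 1)) f))) := by
      intro γ
      rw [QuasiSymm.FRemove_append_singleton]
      by_cases hγ : γ = []
      -- Only `α = (m)` belongs to the empty `γ`, and `R_{ω(α)}` is already `R_{(1^m)}`; the product
      -- rule, which needs nonempty factors, is not involved.
      · subst hγ
        rw [if_pos rfl, add_zero, List.nil_append, QuasiSymm.Comp.omega_singleton,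
          QuasiSymm.Comp.omega_nil, QuasiSymm.R_nil, QuasiSymm.perp_one]
        simp
      · rw [if_neg hγ, QuasiSymm.FRemove_near_singleton m hγ, ← QuasiSymm.perp_mul,
          ← QuasiSymm.R_omega_append_add_R_omega_near m hγ, QuasiSymm.perp_add,
          QuasiSymm.Comp.size_append, QuasiSymm.Comp.size_near, QuasiSymm.Comp.size_cons,
          QuasiSymm.Comp.size_nil, add_zero, pow_add]
        ring
    have hfin' : (Function.support fun γ : QuasiSymm.Comp => (-1 : QuasiSymm.QSym k) ^ γ.size *
        (QuasiSymm.F k γ * QuasiSymm.perp (QuasiSymm.R k γ.omega)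
          (QuasiSymm.perp (QuasiSymm.R k (List.replicate m 1)) f))).Finite :=
      (QuasiSymm.finite_perp_R_omega
        (QuasiSymm.perp (QuasiSymm.R k (List.replicate m 1)) f)).subset fun γ hγ h => hγ (by simp only [h, mul_zero])
    have hsign : (-1 : QuasiSymm.QSym k) ^ (m : ℕ) * (-1) ^ (m : ℕ) = 1 := by
      rw [← mul_pow, show (-1 : QuasiSymm.QSym k) * -1 = 1 by ring, one_pow]
    rw [finsum_congr key, ← mul_finsum' _ _ hfin', ← mul_assoc, hsign, one_mul]
  · exact hfin.subset fun α hα h => hα (by simp only [h, mul_zero])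
  · intro α hα
    exact QuasiSymm.FRemove_ne_zero (k := k) fun h => hα (by simp only [h, zero_mul, mul_zero])
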